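/- Let $d\ge 1$, $r\ge 2$ and $\vec e=(e_1,\dots,e_r)$ be integers with all $e_i\ge 2$ and $2d-2=\sum_{i=1}^r(e_i-1)$. A (genus-$0$, pure-cycle) Hurwitz factorization for $(d,r,0,\vec e)$ is a tuple $(\sigma_1,\dots,\sigma_r)$ of elements of the symmetric group $S_d$ such that $\sigma_i$ is a cycle of length $e_i$ for each $i$, $\sigma_1\cdots\sigma_r=1$, and $\sigma_1,\dots,\sigma_r$ generate a transitive subgroup of $S_d$. (1) Let $(\sigma_1,\dots,\sigma_r)$ and $(\sigma'_1,\dots,\sigma'_r)$ be two Hurwitz factorizations for $(d,r,0,\vec e)$, and let $G=\langle\sigma_1,\dots,\sigma_r\rangle$. Then there is $\tau\in S_d$ such that $\langle\tau\sigma'_1\tau^{-1},\dots,\tau\sigma'_r\tau^{-1}\rangle=G$ and, for every $i$, $\tau\sigma'_i\tau^{-1}$ is conjugate to $\sigma_i$ by an element of $G$. That is, any two Hurwitz factorizations lie in the same Nielsen class. (2) Let $(\sigma_1,\dots,\sigma_r)$ be a Hurwitz factorization for $(d,r,0,\vec e)$, and let $G=\langle\sigma_1,\dots,\sigma_r\rangle$.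 - If $r=2$, then $G$ is isomorphic to the cyclic group $C_d$ of order $d$. - If $r=3$ and $(e_1,e_2,e_3)$ is $(4,4,5)$ up to reordering, then $d=6$, $G\cong S_5$, and $G$ is a doubly transitive subgroup of $S_6$. - In every other case, $G=A_d$ if all $e_i$ are odd, and $G=S_d$ if some $e_i$ is even. -/

import Mathlib

namespace PureCycle

/-- The subgroup `⟨σ₁, …, σᵣ⟩` of `S_d` generated by a tuple of permutations
(the monodromy group of the tuple). -/
def monodromyGroup {d r : ℕ} (σ : Fin r → Equiv.Perm (Fin d)) :
    Subgroup (Equiv.Perm (Fin d)) :=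
  Subgroup.closure (Set.range σ)

/-- `(d, r, g, e)` is the data of a pure-cycle Hurwitz problem. The Riemann-Hurwitz condition
`2d - 2 + 2g = ∑ᵢ (eᵢ - 1)` is stated over the integers. -/
structure IsHurwitzProblem (d r g : ℕ) (e : Fin r → ℕ) : Prop where
  one_le_degree : 1 ≤ d
  two_le_length : 2 ≤ r
  two_le : ∀ i, 2 ≤ e i
  riemann_hurwitz : 2 * (d : ℤ) - 2 + 2 * (g : ℤ) = ∑ i, ((e i : ℤ) - 1)

/-- `σ = (σ₁, …, σᵣ)` is a (pure-cycle) Hurwitz factorization for `(d, r, g, e)`: each `σᵢ` is an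
`eᵢ`-cycle in `S_d`, the ordered product `σ₁ ⋯ σᵣ` is `1`, and the `σᵢ` generate a transitive
subgroup of `S_d`. -/
structure IsHurwitzFactorization (d r g : ℕ) (e : Fin r → ℕ)
    (σ : Fin r → Equiv.Perm (Fin d)) : Prop where
  problem : IsHurwitzProblem d r g e
  isCycle : ∀ i, (σ i).IsCycle
  card_support : ∀ i, (σ i).support.card = e i
  prod_eq_one : (List.ofFn σ).prod = 1
  transitive : MulAction.IsPretransitive (monodromyGroup σ) (Fin d)

/-- Two tuples lie in the same Nielsen class: after simultaneous conjugation of `σ'` by some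
`τ ∈ S_d`, the two tuples generate the same group `G`, and for each `i` the `i`-th entries are
conjugate by an element of `G`. -/
def SameNielsenClass {d r : ℕ} (σ σ' : Fin r → Equiv.Perm (Fin d)) : Prop :=
  ∃ τ : Equiv.Perm (Fin d),
    monodromyGroup (fun i => τ * σ' i * τ⁻¹) = monodromyGroup σ ∧
    ∀ i, ∃ h ∈ monodromyGroup σ, h * σ i * h⁻¹ = τ * σ' i * τ⁻¹

end PureCycle

/-! Everything rests on the lack of slack in the genus-zero count. With at least three factors the
group is primitive (`IsHurwitzFactorization.isPreprimitive`): a nontrivial block system would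
inherit a transitive factorization of the identity, which obeys the Riemann-Hurwitz inequality
`two_mul_card_sub_one_le`, while each cycle must pay for every block it moves with all the points of
that block. The two estimates force `r ≤ 2`.

By Jordan, a primitive group containing a cycle with `k` fixed points is `(k + 1)`-transitive
(`isMultiplyPretransitive_of_isCycle`). A cycle of length at most `(d + 1) / 2` thus has a conjugate
in the group meeting it in a single point, and the commutator of the two is a 3-cycle; primitivity
then gives `A_d`. For `r ≥ 4` so short a cycle always exists. For `r = 3` it may not, but then the
triple is explicit: `exists_isNormalForm` determines it by the lengths up to conjugation, and the
commutator of two factors is a double transposition whenever each factor has a fixed point. With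
4-transitivity this again yields a 3-cycle. What remains is lengths `3, 3, 3`, lengths `5, 5, 5` (a
word that is a 3-cycle) and lengths `4, 4, 5`, the exotic `S₅` in `S₆`, recognized through its
action on five synthemes.

For Nielsen classes, `r ≤ 3` gives simultaneous conjugacy. For `r ≥ 4` both groups are `S_d` or both
are `A_d`, and in `A_d` at most one of the cycles can have an `S_d`-class that splits, so one
conjugation repairs it. -/

namespace PureCycle

open Equiv MulAction

/-! ### The Riemann-Hurwitz inequality by linear algebra on the permutation module. -/

section RiemannHurwitz

variable {Q : Type*} [Fintype Q] [DecidableEq Q]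

/-- The endomorphism `v ↦ v - σ v` of the permutation module `ℚ^Q`. -/
noncomputable def oneSubPerm (σ : Perm Q) : (Q →₀ ℚ) →ₗ[ℚ] (Q →₀ ℚ) :=
  LinearMap.id - Finsupp.lmapDomain ℚ ℚ σ

omit [Fintype Q] [DecidableEq Q] in
lemma oneSubPerm_single (σ : Perm Q) (a : Q) (t : ℚ) :
    oneSubPerm σ (Finsupp.single a t) = Finsupp.single a t - Finsupp.single (σ a) t := by
  simp [oneSubPerm, Finsupp.mapDomain_single]

/-- The image lies in the span of the differences of basis vectors indexed by the support, all taken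
against one base point. For a single cycle this is sharp; for several cycles it is wasteful but
suffices. Truncated subtraction covers the identity. -/
lemma finrank_range_oneSubPerm_le (σ : Perm Q) :
    Module.finrank ℚ (LinearMap.range (oneSubPerm σ)) ≤ σ.support.card - 1 := by
  rcases Finset.eq_empty_or_nonempty σ.support with h | ⟨a₀, ha₀⟩
  · have : σ = 1 := Perm.support_eq_empty_iff.mp h
    subst this
    have : oneSubPerm (1 : Perm Q) = 0 := by
      apply Finsupp.lhom_ext
      intro a b
      simp [oneSubPerm_single]
    simp [this]
  · let f : Q → (Q →₀ ℚ) := fun a => Finsupp.single a 1 - Finsupp.single a₀ 1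
    let T := (σ.support.erase a₀).image f
    have hf : ∀ a ∈ σ.support, f a ∈ Submodule.span ℚ (T : Set (Q →₀ ℚ)) := by
      intro a ha
      by_cases h : a = a₀
      · subst h; simp [f]
      · exact Submodule.subset_span
          (Finset.mem_coe.2 (Finset.mem_image_of_mem _ (Finset.mem_erase.2 ⟨h, ha⟩)))
    have hle : LinearMap.range (oneSubPerm σ) ≤ Submodule.span ℚ (T : Set (Q →₀ ℚ)) := by
      rintro _ ⟨v, rfl⟩
      induction v using Finsupp.induction_linear with
      | zero => simp
      | add v w hv hw => rw [map_add]; exact Submodule.add_mem _ hv hw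
      | single a t =>
        rw [oneSubPerm_single]
        by_cases ha : a ∈ σ.support
        · have h1 := hf a ha
          have h2 := hf (σ a) (Perm.apply_mem_support.2 ha)
          have : Finsupp.single a t - Finsupp.single (σ a) t = t • (f a - f (σ a)) := by
            simp [f, smul_sub]
          rw [this]
          exact Submodule.smul_mem _ _ (Submodule.sub_mem _ h1 h2)
        · rw [Perm.notMem_support.1 ha, sub_self]; exact Submodule.zero_mem _
    calc _ ≤ Module.finrank ℚ (Submodule.span ℚ (T : Set (Q →₀ ℚ))) := Submodule.finrank_mono hle
      _ ≤ T.card := finrank_span_finset_le_card T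
      _ ≤ (σ.support.erase a₀).card := Finset.card_image_le
      _ = _ := Finset.card_erase_of_mem ha₀

/-- A form of the Riemann-Hurwitz inequality: if permutations with product `1` generate a
transitive group, then the sum of their indices is at least `2(|Q| - 1)`. -/
theorem two_mul_card_sub_one_le {r : ℕ} (σ : Fin r → Perm Q)
    (hprod : (List.ofFn σ).prod = 1) (a₀ : Q)
    (htrans : ∀ a : Q, ∃ g ∈ Subgroup.closure (Set.range σ), g a₀ = a) :
    2 * (Fintype.card Q - 1) ≤ ∑ i, ((σ i).support.card - 1) := by
  classical
  let p : ℕ → Perm Q := fun i => ((List.ofFn σ).take i).prod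
  have hp0 : p 0 = 1 := by simp [p]
  have hpr : p r = 1 := by
    simp only [p]
    rw [List.take_of_length_le (by simp), hprod]
  have hps : ∀ i : Fin r, p (i + 1) = p i * σ i := by
    intro i
    simp only [p]
    rw [List.prod_take_succ _ _ (by simp)]
    simp
  let P : Perm Q → (Q →₀ ℚ) →ₗ[ℚ] (Q →₀ ℚ) := fun g => Finsupp.lmapDomain ℚ ℚ g
  have hPmul : ∀ g h v, P (g * h) v = P g (P h v) := by
    intro g h v
    simp only [P, Finsupp.lmapDomain_apply, Perm.coe_mul, Finsupp.mapDomain_comp]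
  have hP1 : ∀ v, P 1 v = v := by
    intro v
    simp [P]
  let V := Q →₀ ℚ
  let R : Fin r → Submodule ℚ V := fun i => LinearMap.range (oneSubPerm (σ i))
  -- `V → ⨁ R i → V` is a complex: weighting the `i`-th component by the partial product `p i` makes
  -- `δ ∘ β` telescope from `p 0 = 1` to `p r = 1`. So the ranks of `β` and `δ` add up to at most `∑
  -- dim R i`, and transitivity bounds each below by `|Q| - 1`.
  let β : V →ₗ[ℚ] (∀ i, R i) := LinearMap.pi fun i => (oneSubPerm (σ i)).rangeRestrict
  let δ : (∀ i, R i) →ₗ[ℚ] V :=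
    ∑ i : Fin r, (P (p i)) ∘ₗ (R i).subtype ∘ₗ LinearMap.proj i
  have hδ : ∀ w, δ w = ∑ i : Fin r, P (p i) (w i) := by
    intro w; simp [δ]
  have hstep : ∀ (i : Fin r) (v : V), P (p i) (oneSubPerm (σ i) v) = P (p i) v - P (p (i + 1)) v := by
    intro i v
    rw [hps, hPmul, ← map_sub]
    rfl
  have hδβ : LinearMap.range β ≤ LinearMap.ker δ := by
    rintro _ ⟨v, rfl⟩
    rw [LinearMap.mem_ker, hδ]
    have : ∀ i : Fin r, P (p i) ((β v i : R i) : V) = P (p i) v - P (p (i + 1)) v := by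
      intro i
      rw [← hstep]
      rfl
    simp only [this]
    rw [Fin.sum_univ_eq_sum_range (fun i => P (p i) v - P (p (i + 1)) v) r,
      Finset.sum_range_sub', hp0, hpr, sub_self]
  -- invariants are constant
  have hker : Module.finrank ℚ (LinearMap.ker β) ≤ 1 := by
    have hinv : ∀ v ∈ LinearMap.ker β, ∀ g ∈ Subgroup.closure (Set.range σ), P g v = v := by
      intro v hv g hg
      induction hg using Subgroup.closure_induction with
      | mem g hg =>
        obtain ⟨i, rfl⟩ := hg
        have h1 : (β v i : V) = 0 := by rw [LinearMap.mem_ker.1 hv]; rfl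
        have h2 : (β v i : V) = v - P (σ i) v := rfl
        rw [h2, sub_eq_zero] at h1
        exact h1.symm
      | one => exact hP1 v
      | mul g h _ _ hg hh => rw [hPmul, hh, hg]
      | inv g _ hg =>
        conv_lhs => rw [← hg]
        rw [← hPmul, inv_mul_cancel, hP1]
    let ev : LinearMap.ker β →ₗ[ℚ] ℚ := (Finsupp.lapply a₀) ∘ₗ (LinearMap.ker β).subtype
    have hev : Function.Injective ev := by
      rw [← LinearMap.ker_eq_bot, LinearMap.ker_eq_bot']
      rintro ⟨v, hv⟩ h0
      have h0' : v a₀ = 0 := h0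
      ext a
      obtain ⟨g, hg, rfl⟩ := htrans a
      have h1 := hinv v hv g hg
      have h2 : (P g v) (g a₀) = v a₀ := by
        simp only [P, Finsupp.lmapDomain_apply]
        exact Finsupp.mapDomain_apply g.injective v a₀
      rw [h1] at h2
      simpa [h0'] using h2
    calc _ ≤ Module.finrank ℚ ℚ := LinearMap.finrank_le_finrank_of_injective hev
      _ = 1 := Module.finrank_self ℚ
  -- Dual to the invariants: modulo the range of `δ` the group acts trivially, so by transitivity
  -- one basis vector spans the quotient.
  have hrange : Fintype.card Q ≤ Module.finrank ℚ (LinearMap.range δ) + 1 := by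
    have hmem : ∀ (i : Fin r) (v : V), P (p i) v - P (p (i + 1)) v ∈ LinearMap.range δ := by
      intro i v
      refine ⟨Pi.single i ⟨oneSubPerm (σ i) v, v, rfl⟩, ?_⟩
      rw [hδ, Finset.sum_eq_single i]
      · rw [← hstep]; simp
      · intro j _ hj; simp [Pi.single_eq_of_ne hj]
      · simp
    have hpi : ∀ i, i ≤ r → ∀ v, v - P (p i) v ∈ LinearMap.range δ := by
      intro i
      induction i with
      | zero => intro _ v; rw [hp0, hP1, sub_self]; exact Submodule.zero_mem _
      | succ i ih =>
        intro hi v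
        have := Submodule.add_mem _ (ih (by omega) v) (hmem ⟨i, hi⟩ v)
        simpa using this
    have hgen : ∀ g ∈ Subgroup.closure (Set.range σ), ∀ v, v - P g v ∈ LinearMap.range δ := by
      intro g hg
      induction hg using Subgroup.closure_induction with
      | mem g hg =>
        obtain ⟨i, rfl⟩ := hg
        intro v
        have h1 := hpi i i.2.le (P (σ i) v)
        have h2 := hpi (i + 1) i.2 v
        rw [hps, hPmul] at h2
        have := Submodule.sub_mem _ h2 h1
        simpa using this
      | one => intro v; rw [hP1, sub_self]; exact Submodule.zero_mem _
      | mul g h _ _ hg hh =>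
        intro v
        have := Submodule.add_mem _ (hh v) (hg (P h v))
        rw [hPmul]; simpa using this
      | inv g _ hg =>
        intro v
        have := hg (P g⁻¹ v)
        rw [← hPmul, mul_inv_cancel, hP1] at this
        simpa using Submodule.neg_mem _ this
    have htop : LinearMap.range δ ⊔ Submodule.span ℚ {Finsupp.single a₀ (1 : ℚ)} = ⊤ := by
      rw [eq_top_iff]
      intro v _
      induction v using Finsupp.induction_linear with
      | zero => exact Submodule.zero_mem _
      | add v w hv hw => exact Submodule.add_mem _ (hv trivial) (hw trivial)
      | single a t =>
        obtain ⟨g, hg, rfl⟩ := htrans a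
        have h1 := hgen g hg (Finsupp.single a₀ t)
        have h2 : Finsupp.single a₀ t ∈ Submodule.span ℚ {Finsupp.single a₀ (1 : ℚ)} :=
          Submodule.mem_span_singleton.2 ⟨t, by simp⟩
        have h3 := Submodule.sub_mem _ (Submodule.mem_sup_right (S := LinearMap.range δ) h2)
          (Submodule.mem_sup_left h1)
        simpa [P, Finsupp.mapDomain_single] using h3
    have h1 := Submodule.finrank_add_le_finrank_add_finrank (LinearMap.range δ)
      (Submodule.span ℚ {Finsupp.single a₀ (1 : ℚ)})
    rw [htop, finrank_top, Module.finrank_finsupp_self,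
      finrank_span_singleton (Finsupp.single_ne_zero.2 one_ne_zero)] at h1
    exact h1
  have h1 := LinearMap.finrank_range_add_finrank_ker β
  have h2 := LinearMap.finrank_range_add_finrank_ker δ
  have h3 := Submodule.finrank_mono hδβ
  rw [Module.finrank_finsupp_self] at h1
  rw [Module.finrank_pi_fintype] at h2
  have h4 : ∑ i, Module.finrank ℚ (R i) ≤ ∑ i, ((σ i).support.card - 1) :=
    Finset.sum_le_sum fun i _ => finrank_range_oneSubPerm_le (σ i)
  omega

end RiemannHurwitz

/-! ### Primitivity of genus-zero factorizations with at least three factors. -/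

section Primitivity

open scoped Pointwise

variable {d r : ℕ} {e : Fin r → ℕ} {σ : Fin r → Perm (Fin d)}

lemma mem_monodromyGroup (σ : Fin r → Perm (Fin d)) (i : Fin r) : σ i ∈ monodromyGroup σ :=
  Subgroup.subset_closure ⟨i, rfl⟩

/-- A permutation acting on a block system moves at least `|B|` points for each block moved. -/
lemma ncard_mul_card_support_le {α : Type*} [Fintype α] [DecidableEq α] {G : Subgroup (Perm α)}
    {B : Set α} (hB : IsBlock G B) [Fintype (orbit G B)] [DecidableEq (orbit G B)] (g : G) :
    B.ncard * (toPerm g : Perm (orbit G B)).support.card ≤ (g : Perm α).support.card := by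
  classical
  have hcard : ∀ q : orbit G B, (q : Set α).toFinset.card = B.ncard := by
    rintro ⟨_, h, rfl⟩
    rw [← Set.ncard_eq_toFinset_card']
    exact Set.ncard_smul_set h B
  have hdisj : ∀ q q' : orbit G B, q ≠ q' → Disjoint (q : Set α) (q' : Set α) := by
    rintro ⟨_, h, rfl⟩ ⟨_, h', rfl⟩ hne
    rcases isBlock_iff_smul_eq_smul_or_disjoint.1 hB h h' with h1 | h1
    · exact absurd (Subtype.ext h1) hne
    · exact h1
  calc _ = ∑ q ∈ (toPerm g : Perm (orbit G B)).support, (q : Set α).toFinset.card := by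
        rw [Finset.sum_congr rfl fun q _ => hcard q, Finset.sum_const, smul_eq_mul, mul_comm]
    _ = ((toPerm g : Perm (orbit G B)).support.biUnion fun q => (q : Set α).toFinset).card := by
        rw [Finset.card_biUnion]
        intro q _ q' _ hne
        exact Set.disjoint_toFinset.2 (hdisj q q' hne)
    _ ≤ _ := by
        apply Finset.card_le_card
        intro x hx
        simp only [Finset.mem_biUnion, Perm.mem_support, Set.mem_toFinset] at hx ⊢
        obtain ⟨q, hq, hxq⟩ := hx
        intro hgx
        have h1 : x ∈ ((toPerm g q : orbit G B) : Set α) :=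
          ⟨x, hxq, hgx⟩
        exact Set.disjoint_left.1 (hdisj _ _ hq) h1 hxq

/-- A genus-zero pure-cycle factorization with at least three factors is primitive. -/
theorem IsHurwitzFactorization.isPreprimitive (h : IsHurwitzFactorization d r 0 e σ)
    (hr : 3 ≤ r) : IsPreprimitive (monodromyGroup σ) (Fin d) := by
  classical
  have := h.transitive
  refine { isTrivialBlock_of_isBlock := ?_ }
  intro B hB
  rcases B.eq_empty_or_nonempty with rfl | hne
  · exact Or.inl Set.subsingleton_empty
  by_contra htriv
  set G := monodromyGroup σ
  let Q := orbit G B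
  let s : Fin r → G := fun i => ⟨σ i, mem_monodromyGroup σ i⟩
  let τ : Fin r → Perm Q := fun i => toPermHom G Q (s i)
  have hτprod : (List.ofFn τ).prod = 1 := by
    have h1 : List.ofFn τ = (List.ofFn s).map (toPermHom G Q) := by
      rw [List.map_ofFn]; rfl
    have h2 : (List.ofFn s).prod = 1 := by
      apply Subtype.ext
      have : ((List.ofFn s).prod : Perm (Fin d)) = ((List.ofFn s).map G.subtype).prod :=
        map_list_prod G.subtype (List.ofFn s)
      rw [this, List.map_ofFn]
      exact h.prod_eq_one
    rw [h1, ← map_list_prod, h2, map_one]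
  have hτgen : ∀ g : G, toPermHom G Q g ∈ Subgroup.closure (Set.range τ) := by
    rintro ⟨g, hg⟩
    induction hg using Subgroup.closure_induction with
    | mem g hg =>
      obtain ⟨i, rfl⟩ := hg
      exact Subgroup.subset_closure ⟨i, rfl⟩
    | one =>
      have := (Subgroup.closure (Set.range τ)).one_mem
      rwa [← map_one (toPermHom G Q)] at this
    | mul x y hx hy ihx ihy =>
      have := Subgroup.mul_mem _ ihx ihy
      rwa [← map_mul] at this
    | inv x hx ihx =>
      have := Subgroup.inv_mem _ ihx
      rwa [← map_inv] at this
  have hRH := two_mul_card_sub_one_le τ hτprod (⟨B, mem_orbit_self B⟩ : Q) (by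
    rintro ⟨_, g, rfl⟩
    exact ⟨_, hτgen g, rfl⟩)
  have hmn : B.ncard * Fintype.card Q = d := by
    have := hB.ncard_block_mul_ncard_orbit_eq hne
    rw [← Nat.card_coe_set_eq (orbit G B), Nat.card_eq_fintype_card, Nat.card_eq_fintype_card,
      Fintype.card_fin] at this
    exact this
  have hm2 : 2 ≤ B.ncard := by
    by_contra hlt
    apply htriv
    left
    rw [← Set.ncard_le_one_iff_subsingleton]
    omega
  have hn2 : 2 ≤ Fintype.card Q := by
    by_contra hlt
    apply htriv
    right
    rw [Set.eq_univ_iff_ncard, Nat.card_eq_fintype_card, Fintype.card_fin]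
    have : 0 < Fintype.card Q := Fintype.card_pos_iff.2 ⟨⟨B, mem_orbit_self B⟩⟩
    have : Fintype.card Q = 1 := by omega
    rw [this, mul_one] at hmn
    exact hmn
  have hsupp : ∀ i, B.ncard * (τ i).support.card ≤ e i := by
    intro i
    rw [← h.card_support i]
    exact ncard_mul_card_support_le hB (s i)
  have hrh := h.problem.riemann_hurwitz
  have h2e := h.problem.two_le
  -- each factor with nontrivial image contributes `B.ncard - 1` extra, each other factor `1`
  have hterm : ∀ i, (B.ncard : ℤ) * (((τ i).support.card - 1 : ℕ) : ℤ) + 1 +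
      (if τ i = 1 then 0 else (B.ncard : ℤ) - 2) ≤ (e i : ℤ) - 1 := by
    intro i
    split_ifs with h1
    · rw [h1]; have := h2e i; simp; omega
    · have h3 : 1 ≤ (τ i).support.card := by
        rw [Nat.one_le_iff_ne_zero, Ne, Finset.card_eq_zero, Perm.support_eq_empty_iff]
        exact h1
      have h4 := hsupp i
      push_cast [h3]
      zify at h4
      linarith
  have hsum := Finset.sum_le_sum fun i (_ : i ∈ Finset.univ) => hterm i
  rw [← hrh] at hsum
  simp only [Finset.sum_add_distrib, ← Finset.mul_sum] at hsum
  -- A single nontrivial factor would equal the whole product, which is `1`; no nontrivial factor at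
  -- all would contradict transitivity on at least two blocks.
  have hcount : (2 : ℤ) * ((B.ncard : ℤ) - 2) ≤
      ∑ i, (if τ i = 1 then 0 else (B.ncard : ℤ) - 2) := by
    -- at least two factors act nontrivially on the blocks
    obtain ⟨i, hi⟩ : ∃ i, τ i ≠ 1 := by
      by_contra! hall
      rw [Finset.sum_eq_zero fun i _ => by rw [hall i]; simp] at hRH
      omega
    obtain ⟨j, hij, hj⟩ : ∃ j, j ≠ i ∧ τ j ≠ 1 := by
      by_contra! hall
      apply hi
      have h1 : τ i = (List.ofFn τ).prod := by
        have : ∀ (n : ℕ) (f : Fin n → Perm Q) (i : Fin n), (∀ j, j ≠ i → f j = 1) →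
            (List.ofFn f).prod = f i := by
          intro n
          induction n with
          | zero => intro f i; exact i.elim0
          | succ n ih =>
            intro f i hf
            rw [List.ofFn_succ, List.prod_cons]
            rcases Fin.eq_zero_or_eq_succ i with rfl | ⟨k, rfl⟩
            · have : (fun j : Fin n => f j.succ) = fun _ => 1 := by
                funext j; exact hf _ (Fin.succ_ne_zero j)
              rw [this]; simp
            · rw [hf 0 (Fin.succ_ne_zero k).symm, one_mul]
              exact ih (fun j => f j.succ) k fun j hj => hf _ (by simpa using hj)
        exact (this r τ i hall).symm
      rw [h1, hτprod]
    have hpos : ∀ k, (0 : ℤ) ≤ (if τ k = 1 then 0 else (B.ncard : ℤ) - 2) := by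
      intro k; split_ifs <;> omega
    have := Finset.sum_le_univ_sum_of_nonneg (s := {i, j}) hpos
    rw [Finset.sum_pair hij.symm, if_neg hi, if_neg hj] at this
    linarith
  -- With `m` points in each of `n` blocks and `d = mn`, the sum reads `2d - 2 ≥ 2m(n - 1) + r + 2(m
  -- - 2) = 2d + r - 4`, so `r ≤ 2`.
  zify at hRH hmn
  rw [Nat.cast_sub (by omega)] at hRH
  simp only [Finset.sum_const, Finset.card_univ, Fintype.card_fin] at hsum
  have hr' : (3 : ℤ) ≤ r := by exact_mod_cast hr
  have hm0 : (0 : ℤ) ≤ B.ncard := by positivity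
  have h5 := mul_le_mul_of_nonneg_left hRH hm0
  push_cast at hsum h5
  simp at hsum
  nlinarith

end Primitivity

end PureCycle

namespace PureCycle

open Equiv MulAction

/-! ### Invariant families of equivalence relations and a cycle. -/

section CycleClasses

variable {α : Type*} [Finite α]

/-- For an equivalence relation preserved by a cycle `c`, the class of a moved point `p`, if it
consists of `b` moved points, is the orbit of `p` under the elements of order dividing `b`. -/
lemma rel_iff_exists_pow_eq_one {c : Perm α} (hc : c.IsCycle) {p : α} (hp : c p ≠ p)
    (E : α → α → Prop) (hrefl : E p p) (hsymm : ∀ x y, E x y → E y x)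
    (htrans : ∀ x y z, E x y → E y z → E x z)
    (hinv : ∀ g ∈ Subgroup.zpowers c, ∀ x y, E x y → E (g x) (g y))
    (hmoved : ∀ q, E p q → c q ≠ q) (q : α) :
    E p q ↔ ∃ g ∈ Subgroup.zpowers c, g ^ {q | E p q}.ncard = 1 ∧ g p = q := by
  classical
  have := Fintype.ofFinite α
  -- The powers of `c` act simply transitively on the moved points, so the class of `p` corresponds
  -- to a subgroup `K`. A cyclic group has at most `b` solutions of `g ^ b = 1`, so `K` is all of
  -- them and depends only on `b`.
  let K : Subgroup (Subgroup.zpowers c) :=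
    { carrier := {g | E p (g.1 p)}
      one_mem' := hrefl
      mul_mem' := fun {g h} hg hh => htrans _ _ _ hg (hinv g.1 g.2 _ _ hh)
      inv_mem' := fun {g} hg => by
        have := hinv g.1⁻¹ (Subgroup.inv_mem _ g.2) _ _ hg
        exact hsymm _ _ (by simpa using this) }
  have hinj : ∀ g h : Subgroup.zpowers c, g.1 p = h.1 p → g = h := by
    intro g h hgh
    have h1 : (g⁻¹ * h).1 p = p := by
      simp [← hgh]
    obtain ⟨n, hn⟩ := mem_powers_iff_mem_zpowers.2 (g⁻¹ * h).2
    simp only at hn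
    rw [← hn, ← hc.pow_eq_one_iff' hp, hn] at h1
    exact inv_mul_eq_one.1 (Subtype.ext h1)
  let f : K ≃ {q | E p q} := Equiv.ofBijective (fun g => ⟨g.1.1 p, g.2⟩) ⟨by
      intro g h hgh
      exact Subtype.ext (hinj _ _ (congrArg Subtype.val hgh)), by
      rintro ⟨q, hq⟩
      obtain ⟨n, hn⟩ := hc.exists_zpow_eq hp (hmoved q hq)
      refine ⟨⟨⟨c ^ n, n, rfl⟩, ?_⟩, Subtype.ext hn⟩
      change E p ((c ^ n) p)
      rw [hn]; exact hq⟩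
  have hK : Nat.card K = {q | E p q}.ncard := by
    rw [Nat.card_congr f, Nat.card_coe_set_eq]
  constructor
  · intro hq
    obtain ⟨g, hg⟩ := f.surjective ⟨q, hq⟩
    refine ⟨g.1.1, g.1.2, ?_, congrArg Subtype.val hg⟩
    have := congrArg (fun g : K => g.1.1) (pow_card_eq_one' (x := g))
    rw [hK] at this
    simpa using this
  · rintro ⟨g, hg, hgb, rfl⟩
    have hle := IsCyclic.card_pow_eq_one_le (α := Subgroup.zpowers c) (n := Nat.card K) Nat.card_pos
    have hsub : Finset.univ.filter (· ∈ K) ⊆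
        Finset.univ.filter (fun a : Subgroup.zpowers c => a ^ Nat.card K = 1) := by
      intro x hx
      simp only [Finset.mem_filter, Finset.mem_univ, true_and] at hx ⊢
      exact congrArg (fun g : K => g.1) (pow_card_eq_one' (x := (⟨x, hx⟩ : K)))
    have hcard : (Finset.univ.filter (· ∈ K)).card = Nat.card K := by
      rw [Nat.card_eq_fintype_card, Fintype.card_subtype]
    have heq := Finset.eq_of_subset_of_card_le hsub (by rw [hcard]; exact hle)
    have : (⟨g, hg⟩ : Subgroup.zpowers c) ∈ Finset.univ.filter (· ∈ K) := by
      rw [heq, Finset.mem_filter]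
      refine ⟨Finset.mem_univ _, Subtype.ext ?_⟩
      rw [hK]; simpa using hgb
    exact (Finset.mem_filter.1 this).2

/-- There is no family of equivalence relations, one on each point complement, with classes of
constant size `b`, each pair being related by `b - 1` of them, that is compatible with a cycle
fixing at least two points. -/
lemma false_of_rel_family {c : Perm α} (hc : c.IsCycle) (R : α → α → α → Prop) (b : ℕ)
    (hfix : ∀ a, c a = a → ∃ a', a' ≠ a ∧ c a' = a') (hfix' : ∃ a, c a = a)
    (hne : ∀ a p q, R a p q → p ≠ a) (hrefl : ∀ a p, p ≠ a → R a p p)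
    (hsymm : ∀ a x y, R a x y → R a y x)
    (htrans : ∀ a x y z, R a x y → R a y z → R a x z)
    (hinv : ∀ a, c a = a → ∀ g ∈ Subgroup.zpowers c, ∀ x y, R a x y → R a (g x) (g y))
    (hclass : ∀ a p, p ≠ a → {q | R a p q}.ncard = b)
    (hcount : ∀ p q, p ≠ q → {a | R a p q}.ncard = b - 1)
    (hb : 2 ≤ b) (hb' : b + 1 < Nat.card α) : False := by
  obtain ⟨p, hp, -⟩ := id hc
  have hfixg : ∀ g ∈ Subgroup.zpowers c, ∀ y, c y = y → g y = y := by
    rintro _ ⟨n, rfl⟩ y hy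
    exact Perm.zpow_apply_eq_self_of_apply_eq_self hy n
  have hnea : ∀ a, c a = a → ∀ z, c z ≠ z → z ≠ a := by
    rintro a ha z hz rfl; exact hz ha
  have hmov : ∀ z, c z ≠ z → ∃ g ∈ Subgroup.zpowers c, g p = z := by
    intro z hz
    obtain ⟨n, hn⟩ := hc.exists_zpow_eq hp hz
    exact ⟨c ^ n, ⟨n, rfl⟩, hn⟩
  -- if the class of `p` contains a fixed point, it contains all moved points
  have htype : ∀ a, c a = a → ∀ y, R a p y → c y = y → ∀ z, c z ≠ z → R a p z := by
    intro a ha y hy hcy z hz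
    obtain ⟨g, hg, rfl⟩ := hmov z hz
    have := hinv a ha g hg _ _ hy
    rw [hfixg g hg y hcy] at this
    exact htrans _ _ _ _ hy (hsymm _ _ _ this)
  -- It is enough to find a class of `R a` made of fixed points only, since `a` itself is one more.
  -- If the class of `p` contains a fixed point, it absorbs all moved points and any other class
  -- will do. Otherwise the class of a second fixed point contains no moved point.
  have hsmall : b + 1 ≤ {a | c a = a}.ncard := by
    obtain ⟨a, ha⟩ := hfix'
    obtain ⟨z, hza, hz⟩ : ∃ z, z ≠ a ∧ ∀ y, R a z y → c y = y := by
      by_cases hI : ∃ y, R a p y ∧ c y = y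
      · obtain ⟨y, hy, hcy⟩ := hI
        obtain ⟨z, hz⟩ : ∃ z, z ∉ insert a {q | R a p q} := by
          by_contra! hall
          have h1 := Set.ncard_insert_le a {q | R a p q}
          rw [Set.eq_univ_of_forall hall, Set.ncard_univ, hclass a p (hnea a ha p hp)] at h1
          omega
        rw [Set.mem_insert_iff, not_or] at hz
        refine ⟨z, hz.1, fun w hw => ?_⟩
        by_contra hcw
        exact hz.2 (htrans _ _ _ _ (htype a ha y hy hcy w hcw) (hsymm _ _ _ hw))
      · push Not at hI
        obtain ⟨β, hβa, hβ⟩ := hfix a ha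
        refine ⟨β, hβa, fun w hw => ?_⟩
        by_contra hcw
        obtain ⟨g, hg, rfl⟩ := hmov w hcw
        have h1 := hinv a ha g⁻¹ (Subgroup.inv_mem _ hg) _ _ hw
        rw [hfixg g⁻¹ (Subgroup.inv_mem _ hg) β hβ, ← Perm.mul_apply, inv_mul_cancel,
          Perm.one_apply] at h1
        exact hI β (hsymm _ _ _ h1) hβ
    rw [← hclass a z hza]
    have hsub : {q | R a z q} ⊆ {a | c a = a} \ {a} := by
      intro y hy
      exact ⟨hz y hy, fun h => hne a y z (hsymm _ _ _ hy) h⟩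
    have h1 := Set.ncard_le_ncard hsub
    have h2 := Set.ncard_sdiff_singleton_add_one (s := {a | c a = a}) (a := a) ha
    omega
  -- For a fixed point `a`, the class of `p` either contains all moved points or consists of moved
  -- points, and in the latter case it is the same set for every such `a`. Hence one `q` serves all
  -- fixed points, giving at least `b + 1` relations where only `b - 1` are allowed.
  obtain ⟨q, hqp, hq⟩ : ∃ q, p ≠ q ∧ ∀ a, c a = a → R a p q := by
    by_cases hII : ∃ a, c a = a ∧ ∀ y, R a p y → c y ≠ y
    · obtain ⟨a, ha, hay⟩ := hII
      obtain ⟨q, hq, hqp⟩ := Set.exists_ne_of_one_lt_ncard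
        (s := {q | R a p q}) (by rw [hclass a p (hnea a ha p hp)]; omega) p
      refine ⟨q, hqp.symm, fun a' ha' => ?_⟩
      by_cases h' : ∀ y, R a' p y → c y ≠ y
      · rw [rel_iff_exists_pow_eq_one hc hp (R a') (hrefl _ _ (hnea a' ha' p hp)) (hsymm a')
          (htrans a') (hinv a' ha') h', hclass a' p (hnea a' ha' p hp)]
        have hq' : R a p q := hq
        rwa [rel_iff_exists_pow_eq_one hc hp (R a) (hrefl _ _ (hnea a ha p hp)) (hsymm a)
          (htrans a) (hinv a ha) hay, hclass a p (hnea a ha p hp)] at hq'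
      · push Not at h'
        obtain ⟨y, hy, hcy⟩ := h'
        exact htype a' ha' y hy hcy q (hay q hq)
    · push Not at hII
      refine ⟨c p, hp.symm, fun a ha => ?_⟩
      obtain ⟨y, hy, hcy⟩ := hII a ha
      exact htype a ha y hy hcy (c p) (fun h => hp (c.injective h))
  have h1 := Set.ncard_le_ncard (s := {a | c a = a}) (t := {a | R a p q}) (fun a ha => hq a ha)
  rw [hcount p q hqp] at h1
  omega

end CycleClasses

/-! ### Jordan's theorem on primitive groups containing a cycle. -/

section Jordan

variable {G α : Type*} [Group G] [MulAction G α] [Finite α]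

/-- Counting in a two-transitive group: each pair of distinct points lies in a common class of
`b - 1` relations of an invariant family with classes of constant size `b`. -/
lemma ncard_rel_family (h2 : IsMultiplyPretransitive G α 2) (R : α → α → α → Prop) (b : ℕ)
    (hn : 2 ≤ Nat.card α)
    (hne : ∀ a p q, R a p q → p ≠ a) (hrefl : ∀ a p, p ≠ a → R a p p)
    (hinv : ∀ (g : G) a x y, R a x y → R (g • a) (g • x) (g • y))
    (hclass : ∀ a p, p ≠ a → {q | R a p q}.ncard = b) {p q : α} (hpq : p ≠ q) :
    {a | R a p q}.ncard = b - 1 := by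
  classical
  have := Fintype.ofFinite α
  have hle : ∀ p q p' q' : α, p ≠ q → p' ≠ q' →
      {a | R a p q}.ncard ≤ {a | R a p' q'}.ncard := by
    intro p q p' q' h h'
    obtain ⟨g, rfl, rfl⟩ := is_two_pretransitive_iff.1 h2 h h'
    rw [← Set.ncard_smul_set g {a | R a p q}]
    refine Set.ncard_le_ncard ?_
    rintro _ ⟨a, ha, rfl⟩
    exact hinv g a p q ha
  -- Double counting of the pairs `(a, q)` with `R a p q` and `a, q ≠ p`: two-transitivity makes the
  -- count over `a` independent of `q`, and the class size gives `b - 1` values of `q` for each `a`.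
  have hconst : ∀ q' ∈ Finset.univ.erase p, ((Finset.univ.erase p).bipartiteBelow
      (fun a q => R a p q) q').card = {a | R a p q}.ncard := by
    intro q' hq'
    have hq'p := Finset.ne_of_mem_erase hq'
    rw [le_antisymm (hle p q p q' hpq hq'p.symm) (hle p q' p q hq'p.symm hpq),
      Set.ncard_eq_toFinset_card']
    congr 1
    ext a
    simp only [Finset.bipartiteBelow, Finset.mem_filter, Finset.mem_erase, Finset.mem_univ,
      and_true, Set.mem_toFinset, Set.mem_ofPred_eq, and_iff_right_iff_imp]
    exact fun h => (hne _ _ _ h).symm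
  have hconst' : ∀ a ∈ Finset.univ.erase p, ((Finset.univ.erase p).bipartiteAbove
      (fun a q => R a p q) a).card = b - 1 := by
    intro a ha
    have hap := Finset.ne_of_mem_erase ha
    rw [← hclass a p hap.symm, ← Set.ncard_sdiff_singleton_of_mem
      (show p ∈ {q | R a p q} from hrefl a p hap.symm),
      Set.ncard_eq_toFinset_card']
    congr 1
    ext q
    simp [Finset.bipartiteAbove, and_comm]
  have := Finset.sum_card_bipartiteAbove_eq_sum_card_bipartiteBelow
    (s := Finset.univ.erase p) (t := Finset.univ.erase p) (fun a q => R a p q)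
  rw [Finset.sum_congr rfl hconst, Finset.sum_congr rfl hconst', Finset.sum_const,
    Finset.sum_const, smul_eq_mul, smul_eq_mul, Finset.card_erase_of_mem (Finset.mem_univ _),
    Finset.card_univ, ← Nat.card_eq_fintype_card] at this
  exact (Nat.eq_of_mul_eq_mul_left (by omega) this).symm

open scoped Pointwise in
/-- In a two-transitive group containing a cycle with at least two fixed points, the point
stabilizers are primitive on the remaining points. -/
theorem isPreprimitive_ofStabilizer_of_isCycle (h2 : IsMultiplyPretransitive G α 2) {g : G}
    (hg : (toPerm g : Perm α).IsCycle) {a a' : α} (ha : g • a = a) (ha' : g • a' = a')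
    (haa' : a' ≠ a) :
    IsPreprimitive (stabilizer G a) (SubMulAction.ofStabilizer G a) := by
  have hn : 2 ≤ Nat.card α := by
    have : Nontrivial α := ⟨a', a, haa'⟩
    exact Finite.one_lt_card
  have : IsPretransitive G α := isPretransitive_of_is_two_pretransitive
  have : IsPretransitive (stabilizer G a) (SubMulAction.ofStabilizer G a) := by
    rw [← is_one_pretransitive_iff, ← SubMulAction.ofStabilizer.isMultiplyPretransitive]
    exact h2
  refine { isTrivialBlock_of_isBlock := ?_ }
  intro B₀ hB₀
  by_contra htriv
  have hB : IsBlock (stabilizer G a) (Subtype.val '' B₀ : Set α) := isBlock_subtypeVal.2 hB₀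
  have haB : a ∉ (Subtype.val '' B₀ : Set α) := SubMulAction.notMem_val_image G B₀
  set B : Set α := Subtype.val '' B₀ with hBdef
  have hBcard : B.ncard = B₀.ncard := Set.ncard_image_of_injective _ Subtype.val_injective
  rw [IsTrivialBlock, not_or] at htriv
  have hb2 : 2 ≤ B.ncard := by
    rw [hBcard]
    by_contra hlt
    exact htriv.1 ((Set.ncard_le_one_iff_subsingleton).1 (by omega))
  have hb3 : B.ncard + 1 < Nat.card α := by
    have h1 : B₀.ncard < Nat.card (SubMulAction.ofStabilizer G a) := by
      refine lt_of_le_of_ne (Set.ncard_le_card B₀) fun h => htriv.2 ?_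
      rwa [Set.eq_univ_iff_ncard]
    have h2 := SubMulAction.nat_card_ofStabilizer_add_one_eq G a
    omega
  -- The block system generated by `B` on the complement of `a`, transported by `G` to the
  -- complement of every point `x`.
  let R : α → α → α → Prop := fun x p q => ∃ k : G, k • a = x ∧ k⁻¹ • p ∈ B ∧ k⁻¹ • q ∈ B
  have hR : ∀ {x p q} (k : G), k • a = x → k⁻¹ • p ∈ B → R x p q → k⁻¹ • q ∈ B := by
    rintro x p q k hk hp ⟨k', hk', hp', hq'⟩
    have hmem : k⁻¹ * k' ∈ stabilizer G a := by
      rw [mem_stabilizer_iff, mul_smul, hk', ← hk, inv_smul_smul]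
    have h1 := (isBlock_iff_smul_eq_of_mem.1 hB) (g := ⟨k⁻¹ * k', hmem⟩) hp'
      (by change (k⁻¹ * k') • k'⁻¹ • p ∈ B; rwa [mul_smul, smul_inv_smul])
    rw [← h1]
    refine ⟨_, hq', ?_⟩
    change (k⁻¹ * k') • k'⁻¹ • q = _
    rw [mul_smul, smul_inv_smul]
  have hex : ∀ x p, p ≠ x → ∃ k : G, k • a = x ∧ k⁻¹ • p ∈ B := by
    intro x p hpx
    obtain ⟨y, hy⟩ : B.Nonempty := (Set.ncard_pos).1 (by omega)
    have hay : a ≠ y := by rintro rfl; exact haB hy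
    obtain ⟨k, hk, rfl⟩ := is_two_pretransitive_iff.1 h2 hay hpx.symm
    exact ⟨k, hk, by rwa [inv_smul_smul]⟩
  have hne : ∀ x p q, R x p q → p ≠ x := by
    rintro x p q ⟨k, hk, hp, -⟩ rfl
    rw [← hk, inv_smul_smul] at hp
    exact haB hp
  have hrefl : ∀ x p, p ≠ x → R x p p := by
    intro x p hpx
    obtain ⟨k, hk, hp⟩ := hex x p hpx
    exact ⟨k, hk, hp, hp⟩
  have hinv : ∀ (g : G) x p q, R x p q → R (g • x) (g • p) (g • q) := by
    rintro g x p q ⟨k, hk, hp, hq⟩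
    exact ⟨g * k, by rw [mul_smul, hk], by simpa [mul_smul] using hp,
      by simpa [mul_smul] using hq⟩
  have hclass : ∀ x p, p ≠ x → {q | R x p q}.ncard = B.ncard := by
    intro x p hpx
    obtain ⟨k, hk, hp⟩ := hex x p hpx
    rw [← Set.ncard_smul_set k B]
    congr 1
    ext q
    rw [Set.mem_smul_set_iff_inv_smul_mem]
    exact ⟨fun h => hR k hk hp h, fun h => ⟨k, hk, hp, h⟩⟩
  refine false_of_rel_family hg R B.ncard ?_ ⟨a, ha⟩ hne hrefl ?_ ?_ ?_ hclass ?_ hb2 hb3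
  · intro x _
    by_cases hxa : x = a
    · exact ⟨a', by rwa [hxa], ha'⟩
    · exact ⟨a, fun h => hxa h.symm, ha⟩
  · rintro x p q ⟨k, hk, hp, hq⟩
    exact ⟨k, hk, hq, hp⟩
  · rintro x p q s ⟨k, hk, hp, hq⟩ h
    exact ⟨k, hk, hp, hR k hk hq h⟩
  · rintro x hx _ ⟨n, rfl⟩ p q h
    have h1 := hinv (g ^ n) x p q h
    have h2 : ∀ y : α, (g ^ n) • y = ((toPerm g : Perm α) ^ n) y := by
      intro y
      rw [← toPermHom_apply, ← map_zpow]; rfl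
    rw [h2, h2, h2, Perm.zpow_apply_eq_self_of_apply_eq_self hx] at h1
    exact h1
  · intro p q hpq
    exact ncard_rel_family h2 R B.ncard hn hne hrefl hinv hclass hpq

/-- **Jordan's theorem on cycles**: a primitive group containing a cycle with `k` fixed points is
`(k + 1)`-transitive. -/
theorem isMultiplyPretransitive_of_isCycle (hG : IsPreprimitive G α) {g : G}
    (hg : (toPerm g : Perm α).IsCycle) {k : ℕ} (hk : {x : α | g • x = x}.ncard = k) :
    IsMultiplyPretransitive G α (k + 1) := by
  induction k generalizing G α with
  | zero => rw [zero_add, is_one_pretransitive_iff]; infer_instance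
  | succ k ih =>
    classical
    have := Fintype.ofFinite α
    set s : Set α := {x : α | g • x = x} with hs
    obtain ⟨y, hy, hcyc⟩ := id hg
    have hcard : k + 2 < Nat.card α := by
      have h1 : insert (g • y) (insert y s) ⊆ Set.univ := Set.subset_univ _
      have h2 := Set.ncard_le_ncard h1
      have h3 : y ∉ s := hy
      have h4 : g • y ∉ insert y s := by
        rw [Set.mem_insert_iff, not_or]
        refine ⟨hy, fun h => hy ?_⟩
        exact smul_left_cancel g h
      rw [Set.ncard_insert_of_notMem h4, Set.ncard_insert_of_notMem h3, hk, Set.ncard_univ] at h2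
      omega
    -- The powers of the cycle fix `s` pointwise and are transitive on its complement, so the
    -- classical Jordan criterion for primitive groups applies. The induction then passes to a point
    -- stabilizer, where the cycle has one fixed point fewer.
    have h2 : IsMultiplyPretransitive G α 2 := by
      refine hG.is_two_pretransitive hk hcard ?_
      have hgs : g ∈ fixingSubgroup G s := by
        rw [mem_fixingSubgroup_iff]; exact fun x hx => hx
      have hpow : ∀ (n : ℤ) (x : α), ((toPerm g : Perm α) ^ n) x = (g ^ n) • x := by
        intro n x
        rw [← toPermHom_apply, ← map_zpow]; rfl
      rw [isPretransitive_iff]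
      rintro ⟨x, hx⟩ ⟨z, hz⟩
      obtain ⟨n, hn⟩ := hg.exists_zpow_eq (x := x) (y := z) hx hz
      refine ⟨⟨g, hgs⟩ ^ n, Subtype.ext ?_⟩
      rw [hpow] at hn
      exact hn
    obtain ⟨a, ha⟩ : s.Nonempty := (Set.ncard_pos).1 (by omega)
    have hpre : IsPretransitive G α := hG.toIsPretransitive
    rw [SubMulAction.ofStabilizer.isMultiplyPretransitive (a := a)]
    rcases Nat.eq_zero_or_pos k with rfl | hkpos
    · rwa [SubMulAction.ofStabilizer.isMultiplyPretransitive (a := a)] at h2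
    · obtain ⟨a', ha', haa'⟩ := Set.exists_ne_of_one_lt_ncard (s := s) (by omega) a
      have hprim := isPreprimitive_ofStabilizer_of_isCycle h2 hg ha ha' haa'
      refine ih hprim (g := ⟨g, ha⟩) ?_ ?_
      · have hne : ∀ x : α, g • x ≠ x → x ≠ a := by rintro x hx rfl; exact hx ha
        refine ⟨⟨y, hne y hy⟩, fun h => hy (congrArg Subtype.val h), ?_⟩
        intro z hz
        have hz' : (toPerm g : Perm α) z ≠ z := fun h => hz (Subtype.ext h)
        obtain ⟨n, hn⟩ := hcyc hz'
        refine ⟨n, Subtype.ext ?_⟩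
        rw [← hn, ← toPermHom_apply, ← map_zpow, ← toPermHom_apply, ← map_zpow]
        rfl
      · have h3 : (Subtype.val '' {x : SubMulAction.ofStabilizer G a |
            (⟨g, ha⟩ : stabilizer G a) • x = x}) = s \ {a} := by
          ext x
          constructor
          · rintro ⟨⟨x, hx⟩, hx', rfl⟩
            exact ⟨congrArg Subtype.val hx', hx⟩
          · rintro ⟨hx, hxa⟩
            exact ⟨⟨x, hxa⟩, Subtype.ext hx, rfl⟩
        rw [← Set.ncard_image_of_injective _ Subtype.val_injective, h3,
          Set.ncard_sdiff_singleton_of_mem ha, hk]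
        rfl

end Jordan

end PureCycle

namespace PureCycle

open Equiv MulAction

/-! ### Producing 3-cycles from short cycles and from double transpositions. -/

section ThreeCycles

variable {α : Type*} [DecidableEq α]

/-- The commutator of two permutations whose supports meet in a single point is a 3-cycle. -/
lemma commutator_eq_swap_mul_swap {f g : Perm α} {x : α} (hf : f x ≠ x) (hg : g x ≠ x)
    (h : ∀ y, f y ≠ y → g y ≠ y → y = x) :
    f * g * f⁻¹ * g⁻¹ = swap x (g x) * swap x (f x) := by
  have hg' : ∀ y, f y ≠ y → y ≠ x → g y = y := fun y h1 h2 => by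
    by_contra h3; exact h2 (h y h1 h3)
  have hf' : ∀ y, g y ≠ y → y ≠ x → f y = y := fun y h1 h2 => by
    by_contra h3; exact h2 (h y h3 h1)
  have hgfx : g (f x) = f x := hg' _ (fun h => hf (f.injective h)) hf
  have hfgx : f (g x) = g x := hf' _ (fun h => hg (g.injective h)) hg
  have hne : f x ≠ g x := fun h1 => hg (by rw [h1] at hgfx; exact g.injective hgfx)
  rw [mul_inv_eq_iff_eq_mul, mul_inv_eq_iff_eq_mul]
  ext y
  simp only [Perm.mul_apply]
  by_cases hyx : y = x
  · subst hyx
    rw [hfgx, hgfx, swap_apply_right, swap_apply_left]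
  by_cases hfy : f y = y
  · rw [hfy]
    by_cases hgy : g y = y
    · rw [hgy, hfy, swap_apply_of_ne_of_ne hyx, swap_apply_of_ne_of_ne hyx]
      · rintro rfl; exact hyx (g.injective hgy)
      · rintro rfl; exact hyx (f.injective hfy)
    · by_cases hgyx : g y = x
      · rw [hgyx, swap_apply_left, swap_apply_of_ne_of_ne hf hne]
      · rw [hf' (g y) (fun h => hgy (g.injective h)) hgyx]
        rw [swap_apply_of_ne_of_ne hgyx, swap_apply_of_ne_of_ne hgyx]
        · exact fun h => hyx (g.injective h)
        · intro h
          rw [← hgfx] at h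
          rw [g.injective h] at hfy
          exact hf (f.injective hfy)
  · have hgy := hg' y hfy hyx
    rw [hgy]
    by_cases hfyx : f y = x
    · rw [hfyx]
      have h1 : g x ≠ f x := hne.symm
      rw [swap_apply_of_ne_of_ne hg h1, swap_apply_right]
    · rw [hg' (f y) (fun h => hfy (f.injective h)) hfyx, swap_apply_of_ne_of_ne hfyx,
        swap_apply_of_ne_of_ne hfyx]
      · intro h; rw [← hfgx] at h
        have := f.injective h
        rw [this] at hgy
        exact hg (g.injective hgy)
      · exact fun h => hyx (f.injective h)

variable [Fintype α]

lemma isThreeCycle_commutator {f g : Perm α} {x : α} (hf : f x ≠ x) (hg : g x ≠ x)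
    (h : ∀ y, f y ≠ y → g y ≠ y → y = x) : (f * g * f⁻¹ * g⁻¹).IsThreeCycle := by
  rw [commutator_eq_swap_mul_swap hf hg h]
  refine Perm.isThreeCycle_swap_mul_swap_same hg.symm hf.symm fun h1 => ?_
  have := h (f x) (fun h => hf (f.injective h)) (by rw [← h1]; exact fun h => hg (g.injective h))
  exact hf this

variable {G : Subgroup (Perm α)}

/-- Jordan's theorem on cycles, for permutation groups. -/
theorem isMultiplyPretransitive_of_isCycle_mem (hG : IsPreprimitive G α) {c : Perm α}
    (hc : c.IsCycle) (hcG : c ∈ G) :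
    IsMultiplyPretransitive G α (Fintype.card α - c.support.card + 1) := by
  refine isMultiplyPretransitive_of_isCycle hG (g := ⟨c, hcG⟩) hc ?_
  have : {x : α | (⟨c, hcG⟩ : G) • x = x} = ((c.supportᶜ : Finset α) : Set α) := by
    ext x
    simp only [Finset.coe_compl, Set.mem_compl_iff, Finset.mem_coe, Perm.mem_support, not_not]
    rfl
  rw [this, Set.ncard_coe_finset, Finset.card_compl]

omit [DecidableEq α] [Fintype α] in
lemma exists_embedding_range {m : ℕ} {s : Finset α} (hs : s.card = m) :
    ∃ x : Fin m ↪ α, ∀ a, a ∈ s ↔ ∃ i, x i = a := by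
  subst hs
  refine ⟨s.equivFin.symm.toEmbedding.trans (Function.Embedding.subtype _), fun a => ?_⟩
  constructor
  · intro ha
    exact ⟨s.equivFin ⟨a, ha⟩, by simp⟩
  · rintro ⟨i, rfl⟩
    exact (s.equivFin.symm i).2

/-- A primitive group containing a cycle of length at most `(|α| + 1) / 2` contains a 3-cycle. -/
theorem exists_isThreeCycle_of_two_mul_card_support_le (hG : IsPreprimitive G α) {c : Perm α}
    (hc : c.IsCycle) (hcG : c ∈ G) (hcard : 2 * c.support.card ≤ Fintype.card α + 1) :
    ∃ g ∈ G, g.IsThreeCycle := by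
  have h2 := hc.two_le_card_support
  have := isMultiplyPretransitive_of_isCycle_mem hG hc hcG
  -- The length bound is used twice: here for enough transitivity to move the support anywhere, and
  -- below for room to choose `T` outside it. The conjugate supported on `insert x₀ T` then meets
  -- `c` only in `x₀`.
  have htrans : IsMultiplyPretransitive G α c.support.card :=
    isMultiplyPretransitive_of_le (n := Fintype.card α - c.support.card + 1) (by omega)
      (by rw [Nat.card_eq_fintype_card]; omega)
  obtain ⟨x₀, hx₀⟩ := Finset.card_pos.1 (show 0 < c.support.card by omega)
  obtain ⟨T, hT, hTcard⟩ := Finset.exists_subset_card_eq (s := c.supportᶜ)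
    (n := c.support.card - 1) (by rw [Finset.card_compl]; omega)
  have hx₀T : x₀ ∉ T := fun h => Finset.mem_compl.1 (hT h) hx₀
  obtain ⟨x, hx⟩ := exists_embedding_range (s := c.support) rfl
  obtain ⟨y, hy⟩ := exists_embedding_range (s := insert x₀ T) (m := c.support.card)
    (by rw [Finset.card_insert_of_notMem hx₀T, hTcard]; omega)
  obtain ⟨g, hg⟩ := exists_smul_eq G x y
  have hgx : ∀ i, (g : Perm α) (x i) = y i := fun i => by rw [← hg]; rfl
  have hsupp : ∀ a, (g * c * (g : Perm α)⁻¹) a ≠ a ↔ a ∈ insert x₀ T := by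
    intro a
    rw [hy, ← Perm.mem_support, Perm.support_conj, Finset.mem_map]
    constructor
    · rintro ⟨b, hb, rfl⟩
      obtain ⟨i, rfl⟩ := (hx b).1 hb
      exact ⟨i, (hgx i).symm⟩
    · rintro ⟨i, rfl⟩
      exact ⟨x i, (hx _).2 ⟨i, rfl⟩, hgx i⟩
  have hg'G : (g * c * (g : Perm α)⁻¹) ∈ G := G.mul_mem (G.mul_mem g.2 hcG) (G.inv_mem g.2)
  refine ⟨_, G.mul_mem (G.mul_mem (G.mul_mem hcG hg'G) (G.inv_mem hcG)) (G.inv_mem hg'G),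
    isThreeCycle_commutator (x := x₀) (Perm.mem_support.1 hx₀)
      ((hsupp _).2 (Finset.mem_insert_self _ _)) ?_⟩
  intro a ha ha'
  rcases Finset.mem_insert.1 ((hsupp a).1 ha') with h | h
  · exact h
  · exact absurd (Perm.mem_support.2 ha) (Finset.mem_compl.1 (hT h))

/-- A 4-transitive group of degree at least five containing a double transposition contains a
3-cycle. -/
theorem exists_isThreeCycle_of_double_swap (hG : IsMultiplyPretransitive G α 4)
    (hcard : 5 ≤ Fintype.card α) {a b c d : α} (hnd : [a, b, c, d].Nodup)
    (hmem : swap a b * swap c d ∈ G) : ∃ g ∈ G, g.IsThreeCycle := by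
  obtain ⟨d', hd'⟩ : ∃ d', d' ∉ [a, b, c, d].toFinset := by
    by_contra! h
    have h1 := Finset.card_le_card (fun x (_ : x ∈ Finset.univ) => h x)
    rw [List.toFinset_card_of_nodup hnd, Finset.card_univ] at h1
    simp at h1
    omega
  simp only [List.mem_toFinset, List.mem_cons, List.not_mem_nil, or_false, not_or] at hd'
  simp only [List.nodup_cons, List.mem_cons, List.not_mem_nil, or_false, not_or,
    not_false_eq_true, List.nodup_nil, and_true] at hnd
  obtain ⟨⟨hab, hac, had⟩, ⟨hbc, hbd⟩, hcd⟩ := hnd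
  let x : Fin 4 ↪ α := ⟨![a, b, c, d], by
    intro i j; fin_cases i <;> fin_cases j <;> simp_all [eq_comm]⟩
  let y : Fin 4 ↪ α := ⟨![a, b, c, d'], by
    intro i j; fin_cases i <;> fin_cases j <;> simp_all [eq_comm]⟩
  -- Conjugation by `g` changes only `d` into `d'`, so the common transposition `swap a b` cancels
  -- from the quotient.
  obtain ⟨g, hg⟩ := exists_smul_eq G x y
  have hgx : ∀ i, (g : Perm α) (x i) = y i := fun i => by rw [← hg]; rfl
  have ha : (g : Perm α) a = a := hgx 0
  have hb : (g : Perm α) b = b := hgx 1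
  have hc : (g : Perm α) c = c := hgx 2
  have hd : (g : Perm α) d = d' := hgx 3
  have h1 : (g : Perm α) * (swap a b * swap c d) * (g : Perm α)⁻¹ = swap a b * swap c d' := by
    rw [mul_inv_eq_iff_eq_mul, ← mul_assoc, mul_swap_eq_swap_mul (g : Perm α) a b, ha, hb, mul_assoc,
      mul_swap_eq_swap_mul (g : Perm α) c d, hc, hd, mul_assoc]
  have h2 : (swap a b * swap c d)⁻¹ * (swap a b * swap c d') = swap c d * swap c d' := by
    rw [mul_inv_rev, swap_inv, swap_inv, mul_assoc, swap_mul_self_mul]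
  refine ⟨_, ?_, Perm.isThreeCycle_swap_mul_swap_same hcd (Ne.symm hd'.2.2.1) (Ne.symm hd'.2.2.2)⟩
  rw [← h2]
  refine G.mul_mem (G.inv_mem hmem) ?_
  rw [← h1]
  exact G.mul_mem (G.mul_mem g.2 hmem) (G.inv_mem g.2)

end ThreeCycles

end PureCycle

namespace PureCycle

open Equiv

/-! ### Writing cycles as lists. -/

section CycleLists

variable {α : Type*}

lemma exists_eq_append_of_isChain (P : α → Prop) :
    ∀ l : List α, l.IsChain (fun p q => P p → P q) →
      ∃ L M, l = L ++ M ∧ (∀ p ∈ L, ¬ P p) ∧ ∀ p ∈ M, P p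
  | [], _ => ⟨[], [], rfl, by simp, by simp⟩
  | [a], _ => by
    by_cases h : P a
    · exact ⟨[], [a], rfl, by simp, by simpa⟩
    · exact ⟨[a], [], rfl, by simpa, by simp⟩
  | a :: b :: l, h => by
    rw [List.isChain_cons_cons] at h
    obtain ⟨L, M, hl, hL, hM⟩ := exists_eq_append_of_isChain P (b :: l) h.2
    by_cases ha : P a
    · have hb := h.1 ha
      rcases L with _ | ⟨c, L⟩
      · refine ⟨[], a :: M, by simp [hl], by simp, ?_⟩
        intro p hp
        rcases List.mem_cons.1 hp with rfl | hp
        · exact ha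
        · exact hM p hp
      · rw [List.cons_append, List.cons.injEq] at hl
        exact absurd (hl.1 ▸ hb) (hL c List.mem_cons_self)
    · refine ⟨a :: L, M, by simp [hl], ?_, hM⟩
      intro p hp
      rcases List.mem_cons.1 hp with rfl | hp
      · exact ha
      · exact hL p hp

lemma eq_of_isChain_apply (f : α → α) : ∀ (x : α) (l l' : List α),
    (x :: l).IsChain (fun p q => q = f p) → (x :: l').IsChain (fun p q => q = f p) →
    l.length = l'.length → l = l'
  | _, [], [], _, _, _ => rfl
  | x, a :: l, b :: l', h, h', hlen => by
    rw [List.isChain_cons_cons] at h h'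
    obtain ⟨rfl, h⟩ := h
    obtain ⟨rfl, h'⟩ := h'
    rw [eq_of_isChain_apply f _ l l' h h' (by simpa using hlen)]

variable [DecidableEq α]

lemma isChain_formPerm {l : List α} (hl : l.Nodup) :
    l.IsChain (fun p q => q = l.formPerm p) := by
  rw [List.isChain_iff_getElem]
  intro i hi
  exact (List.formPerm_apply_lt_getElem l hl i hi).symm

lemma map_formPerm {l : List α} (hl : l.Nodup) : l.map l.formPerm = l.rotate 1 := by
  apply List.ext_getElem (by simp)
  intro i h1 h2
  rw [List.getElem_map, List.getElem_rotate, List.formPerm_apply_getElem l hl]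

lemma formPerm_map (τ : Perm α) : ∀ l : List α,
    (l.map τ).formPerm = τ * l.formPerm * τ⁻¹
  | [] => by simp
  | [a] => by simp
  | a :: b :: l => by
    have := formPerm_map τ (b :: l)
    rw [List.map_cons] at this
    rw [List.map_cons, List.map_cons, List.formPerm_cons_cons, List.formPerm_cons_cons, this,
      ← mul_assoc τ, mul_swap_eq_swap_mul, mul_assoc, mul_assoc, mul_assoc]

/-- A cycle written as a list starting at `x`, split according to a predicate that persists along
the cycle until it returns to `x`. -/
lemma exists_formPerm_append [Fintype α] {s : Perm α} (hs : s.IsCycle) {x : α} (hx : s x ≠ x)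
    (P : α → Prop) (hP : ∀ p, s p ≠ p → P p → s p ≠ x → P (s p)) :
    ∃ L M, s = (x :: (L ++ M)).formPerm ∧ (x :: (L ++ M)).Nodup ∧
      (∀ p, p ∈ x :: (L ++ M) ↔ s p ≠ p) ∧ (∀ p ∈ L, ¬ P p) ∧ ∀ p ∈ M, P p := by
  have hform : (s.toList x).formPerm = s := by rw [Perm.formPerm_toList, hs.cycleOf_eq hx]
  have hnd : (s.toList x).Nodup := Perm.nodup_toList s x
  have hmem : ∀ p, p ∈ s.toList x ↔ s p ≠ p := by
    intro p
    rw [Perm.mem_toList_iff, Perm.mem_support]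
    constructor
    · rintro ⟨h1, h2⟩
      exact fun h => h2 (h1.apply_eq_self_iff.2 h)
    · intro h
      exact ⟨hs.sameCycle hx h, hx⟩
  rcases hl : s.toList x with _ | ⟨y, l⟩
  · exact absurd hl (fun h => Perm.toList_eq_nil_iff.1 h (Perm.mem_support.2 hx))
  have hy : y = x := by
    have h0 : 0 < (s.toList x).length := by rw [hl]; simp
    have h1 := Perm.getElem_toList s x 0 h0
    simp only [hl] at h1
    simpa using h1
  subst hy
  rw [hl] at hform hnd hmem
  have hchain := isChain_formPerm hnd
  rw [hform] at hchain
  have hchain' : l.IsChain (fun p q => P p → P q) := by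
    refine hchain.tail.imp_of_mem_imp fun p q hp hq hpq hPp => ?_
    rw [hpq]
    refine hP p ((hmem p).1 (List.mem_cons_of_mem _ hp)) hPp ?_
    rw [← hpq]
    rintro rfl
    exact (List.nodup_cons.1 hnd).1 hq
  obtain ⟨L, M, rfl, hL, hM⟩ := exists_eq_append_of_isChain P l hchain'
  exact ⟨L, M, hform.symm, hnd, hmem, hL, hM⟩

end CycleLists

/-! ### Normal form and rigidity of triples of cycles. -/

section NormalForm

variable {α : Type*} [Fintype α] [DecidableEq α]

/-- The normal form of three permutations arising from a planar picture of three polygons. -/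
structure IsNormalForm (s : Fin 3 → Perm α) (x : α) (la lb lc : List α) : Prop where
  nodup : (x :: (la ++ lb ++ lc)).Nodup
  mem : ∀ p, p ∈ x :: (la ++ lb ++ lc)
  length_a : la.length + (s 2).support.card = Fintype.card α
  length_b : lb.length + (s 1).support.card = Fintype.card α
  length_c : lc.length + (s 0).support.card = Fintype.card α
  eq_zero : s 0 = (x :: (la ++ lb)).formPerm
  eq_one : s 1 = (x :: (lc ++ la.reverse)).formPerm
  prod : s 0 * s 1 * s 2 = 1

/-- A point fixed by two of the permutations is fixed by the third, so the three fixed-point sets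
are disjoint and, by the count, miss exactly one point `x`. These sets are `la` (for `s 2`), `lb`
(for `s 1`) and `lc` (for `s 0`). Each is traversed without interruption by the cycles that move it.
-/
theorem exists_isNormalForm {s : Fin 3 → Perm α} (hs : ∀ i, (s i).IsCycle)
    (hprod : s 0 * s 1 * s 2 = 1)
    (hsum : (s 0).support.card + (s 1).support.card + (s 2).support.card =
      2 * Fintype.card α + 1)
    (hmov : ∀ p, ¬ (s 0 p = p ∧ s 1 p = p ∧ s 2 p = p)) :
    ∃ x la lb lc, IsNormalForm s x la lb lc := by
  have happ : ∀ p, s 0 (s 1 (s 2 p)) = p := fun p => by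
    rw [← Perm.mul_apply, ← Perm.mul_apply, hprod, Perm.one_apply]
  have happ' : ∀ p, s 2 (s 0 (s 1 p)) = p := fun p => by
    apply (s 1).injective; apply (s 0).injective; rw [happ]
  have happ'' : ∀ p, s 1 (s 2 (s 0 p)) = p := fun p => by
    apply (s 0).injective; rw [happ]
  have h01 : ∀ p, s 0 p = p → s 1 p = p → s 2 p = p := by
    intro p h0 h1
    have := happ' p
    rwa [h1, h0] at this
  have h12 : ∀ p, s 1 p = p → s 2 p = p → s 0 p = p := by
    intro p h1 h2
    have := happ p
    rwa [h2, h1] at this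
  have h02 : ∀ p, s 0 p = p → s 2 p = p → s 1 p = p := by
    intro p h0 h2
    have := happ'' p
    rwa [h0, h2] at this
  have hF : ∀ i p, p ∈ (s i).supportᶜ ↔ s i p = p := by
    intro i p
    rw [Finset.mem_compl, Perm.mem_support, not_not]
  have hcardF : ∀ i, (s i).supportᶜ.card + (s i).support.card = Fintype.card α := by
    intro i
    rw [add_comm, Finset.card_add_card_compl]
  -- exactly one point is moved by all three permutations
  have hd01 : Disjoint (s 0).supportᶜ (s 1).supportᶜ := by
    rw [Finset.disjoint_left]
    intro p h0 h1
    rw [hF] at h0 h1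
    exact hmov p ⟨h0, h1, h01 p h0 h1⟩
  have hd012 : Disjoint ((s 0).supportᶜ ∪ (s 1).supportᶜ) (s 2).supportᶜ := by
    rw [Finset.disjoint_left]
    intro p h h2
    rw [Finset.mem_union, hF, hF] at h
    rw [hF] at h2
    rcases h with h | h
    · exact hmov p ⟨h, h02 p h h2, h2⟩
    · exact hmov p ⟨h12 p h h2, h, h2⟩
  have hcompl : (((s 0).supportᶜ ∪ (s 1).supportᶜ) ∪ (s 2).supportᶜ)ᶜ.card = 1 := by
    rw [Finset.card_compl, Finset.card_union_of_disjoint hd012,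
      Finset.card_union_of_disjoint hd01]
    have h0 := hcardF 0
    have h1 := hcardF 1
    have h2 := hcardF 2
    omega
  obtain ⟨x, hx⟩ := Finset.card_eq_one.1 hcompl
  have hx' : ∀ p, (s 0 p ≠ p ∧ s 1 p ≠ p ∧ s 2 p ≠ p) ↔ p = x := by
    intro p
    rw [← Finset.mem_singleton, ← hx, Finset.mem_compl, Finset.mem_union, Finset.mem_union, hF, hF,
      hF, not_or, not_or, and_assoc]
  obtain ⟨hx0, hx1, hx2⟩ := (hx' x).2 rfl
  -- Starting at `x`, once the cycle `s 0` reaches a fixed point of `s 1` it stays among them until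
  -- it returns: otherwise the next point would be fixed by `s 2`, and the product relation would
  -- make `s 0` fix the current point.
  obtain ⟨la, lb, he0, hnd0, hmem0, hla, hlb⟩ := exists_formPerm_append (hs 0) hx0
    (fun p => s 1 p = p) (by
      intro p hp0 hp1 hpx
      by_contra h1
      have h2 : s 2 (s 0 p) = s 0 p := by
        by_contra h2
        exact hpx ((hx' _).1 ⟨fun h => hp0 ((s 0).injective h), h1, h2⟩)
      have h3 := happ' p
      rw [hp1, h2] at h3
      exact hp0 h3)
  obtain ⟨lc, la', he1, hnd1, hmem1, hlc, hla'⟩ := exists_formPerm_append (hs 1) hx1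
    (fun p => s 2 p = p) (by
      intro p hp1 hp2 hpx
      by_contra h2
      have h0 : s 0 (s 1 p) = s 1 p := by
        by_contra h0
        exact hpx ((hx' _).1 ⟨h0, fun h => hp1 ((s 1).injective h), h2⟩)
      have h3 := happ p
      rw [hp2, h0] at h3
      exact hp1 h3)
  have hne0 : ∀ p ∈ la ++ lb, p ≠ x := by
    rintro p hp rfl; exact (List.nodup_cons.1 hnd0).1 hp
  have hne1 : ∀ p ∈ lc ++ la', p ≠ x := by
    rintro p hp rfl; exact (List.nodup_cons.1 hnd1).1 hp
  have hxm : ∀ {l : List α}, (∀ p ∈ l, p ≠ x) → ∀ {p}, p ≠ x → (p ∈ x :: l ↔ p ∈ l) := by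
    intro l _ p hp
    rw [List.mem_cons]
    exact ⟨fun h => h.resolve_left hp, Or.inr⟩
  have hmla : ∀ p, p ∈ la ↔ s 2 p = p := by
    intro p
    constructor
    · intro hp
      have h1 := hla p hp
      have h0 := (hmem0 p).1 (by simp [hp])
      by_contra h2
      exact hne0 p (by simp [hp]) ((hx' p).1 ⟨h0, h1, h2⟩)
    · intro h2
      have h0 : s 0 p ≠ p := fun h0 => hmov p ⟨h0, h02 p h0 h2, h2⟩
      have h1 : s 1 p ≠ p := fun h1 => hmov p ⟨h12 p h1 h2, h1, h2⟩
      have hpx : p ≠ x := by rintro rfl; exact hx2 h2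
      have := (hxm hne0 hpx).1 ((hmem0 p).2 h0)
      rcases List.mem_append.1 this with h | h
      · exact h
      · exact absurd (hlb p h) h1
  have hmlb : ∀ p, p ∈ lb ↔ s 1 p = p := by
    intro p
    refine ⟨hlb p, fun h1 => ?_⟩
    have h0 : s 0 p ≠ p := fun h0 => hmov p ⟨h0, h1, h01 p h0 h1⟩
    have hpx : p ≠ x := by rintro rfl; exact hx1 h1
    have := (hxm hne0 hpx).1 ((hmem0 p).2 h0)
    rcases List.mem_append.1 this with h | h
    · exact absurd h1 (hla p h)
    · exact h
  have hmla' : ∀ p, p ∈ la' ↔ s 2 p = p := by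
    intro p
    refine ⟨hla' p, fun h2 => ?_⟩
    have h1 : s 1 p ≠ p := fun h1 => hmov p ⟨h12 p h1 h2, h1, h2⟩
    have hpx : p ≠ x := by rintro rfl; exact hx2 h2
    have := (hxm hne1 hpx).1 ((hmem1 p).2 h1)
    rcases List.mem_append.1 this with h | h
    · exact absurd h2 (hlc p h)
    · exact h
  have hmlc : ∀ p, p ∈ lc ↔ s 0 p = p := by
    intro p
    constructor
    · intro hp
      have h2 := hlc p hp
      have h1 := (hmem1 p).1 (by simp [hp])
      by_contra h0
      exact hne1 p (by simp [hp]) ((hx' p).1 ⟨h0, h1, h2⟩)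
    · intro h0
      have h1 : s 1 p ≠ p := fun h1 => hmov p ⟨h0, h1, h01 p h0 h1⟩
      have h2 : s 2 p ≠ p := fun h2 => hmov p ⟨h0, h02 p h0 h2, h2⟩
      have hpx : p ≠ x := by rintro rfl; exact hx0 h0
      have := (hxm hne1 hpx).1 ((hmem1 p).2 h1)
      rcases List.mem_append.1 this with h | h
      · exact h
      · exact absurd (hla' p h) h2
  have hndab := (List.nodup_cons.1 hnd0).2
  have hndca := (List.nodup_cons.1 hnd1).2
  have hlen : ∀ (l : List α) (i : Fin 3), l.Nodup → (∀ p, p ∈ l ↔ s i p = p) →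
      l.length + (s i).support.card = Fintype.card α := by
    intro l i hl hmem
    rw [← hcardF i, ← List.toFinset_card_of_nodup hl]
    congr 2
    ext p
    rw [List.mem_toFinset, hmem, hF]
  -- On the fixed points of `s 2`, `s 0` undoes `s 1`; so `s 1` read backwards from `x` follows the
  -- same orbit as `s 0` read forwards.
  have hrev : la' = la.reverse := by
    rw [← List.reverse_eq_iff, eq_comm]
    have hchain0 : (x :: la).IsChain (fun p q => q = s 0 p) := by
      have h := isChain_formPerm hnd0
      rw [← he0, ← List.cons_append, List.isChain_append] at h
      exact h.1
    have hchain1 : (x :: la'.reverse).IsChain (fun p q => q = s 0 p) := by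
      have h : ((x :: (lc ++ la')) ++ [x]).IsChain (fun p q => q = s 1 p) := by
        rw [List.isChain_append]
        refine ⟨by rw [he1]; exact isChain_formPerm hnd1, List.isChain_singleton _, ?_⟩
        intro p hp q hq
        rw [List.getLast?_eq_getLast_of_ne_nil (List.cons_ne_nil _ _), Option.mem_some] at hp
        have hq' : x = q := by simpa using hq
        rw [← hp, ← hq']
        conv_rhs => rw [he1]
        exact (List.formPerm_apply_getLast x _).symm
      rw [← List.cons_append, List.append_assoc, List.isChain_append] at h
      have h' : (x :: la'.reverse).IsChain (fun p q => p = s 1 q) := by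
        rw [← List.isChain_reverse, List.reverse_cons, List.reverse_reverse]
        exact h.2.1
      refine h'.imp_of_mem_tail_imp fun p q _ hq hpq => ?_
      have h2 : s 2 q = q := hla' q (List.mem_reverse.1 hq)
      have h3 := happ q
      rw [h2] at h3
      rw [hpq, h3]
    refine eq_of_isChain_apply (s 0) x la la'.reverse hchain0 hchain1 ?_
    have h1 := hlen la 2 (List.Nodup.of_append_left hndab) hmla
    have h2 := hlen la' 2 (List.Nodup.of_append_right hndca) hmla'
    rw [List.length_reverse]
    omega
  refine ⟨x, la, lb, lc, ?_, ?_, hlen la 2 (List.Nodup.of_append_left hndab) hmla,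
    hlen lb 1 (List.Nodup.of_append_right hndab) hmlb,
    hlen lc 0 (List.Nodup.of_append_left hndca) hmlc, he0, hrev ▸ he1, hprod⟩
  · rw [← List.cons_append]
    refine List.Nodup.append hnd0 (List.Nodup.of_append_left hndca) ?_
    intro p hp hp'
    exact (hmem0 p).1 hp ((hmlc p).1 hp')
  · intro p
    rw [← List.cons_append, List.mem_append]
    by_cases h : s 0 p = p
    · exact Or.inr ((hmlc p).2 h)
    · exact Or.inl ((hmem0 p).2 h)

/-- Two triples in normal form with equal cycle lengths are simultaneously conjugate. -/
theorem IsNormalForm.exists_conj {s s' : Fin 3 → Perm α} {x x' : α} {la lb lc la' lb' lc' : List α}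
    (h : IsNormalForm s x la lb lc) (h' : IsNormalForm s' x' la' lb' lc')
    (ha : la.length = la'.length) (hb : lb.length = lb'.length) (hc : lc.length = lc'.length) :
    ∃ τ : Perm α, x = τ x' ∧ la = la'.map τ ∧ lb = lb'.map τ ∧ lc = lc'.map τ ∧
      ∀ i, s i = τ * s' i * τ⁻¹ := by
  have hlen : (x' :: (la' ++ lb' ++ lc')).length = (x :: (la ++ lb ++ lc)).length := by
    simp [ha, hb, hc]
  obtain ⟨τ, hτ⟩ := Perm.exists_extending_pair (x' :: (la' ++ lb' ++ lc')).get
    (fun i => (x :: (la ++ lb ++ lc)).get (i.cast hlen))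
    (List.nodup_iff_injective_get.1 h'.nodup)
    ((List.nodup_iff_injective_get.1 h.nodup).comp (Fin.cast_injective hlen))
  have hmap : x :: (la ++ lb ++ lc) = (x' :: (la' ++ lb' ++ lc')).map τ := by
    apply List.ext_getElem (by simpa using hlen.symm)
    intro i h1 h2
    have := hτ ⟨i, by simpa using h2⟩
    rw [List.getElem_map]
    simpa using this.symm
  rw [List.map_cons, List.map_append, List.map_append, List.cons.injEq] at hmap
  obtain ⟨hx, hmap⟩ := hmap
  obtain ⟨hmap, hlc⟩ := List.append_inj hmap (by simp [ha, hb])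
  obtain ⟨hla, hlb⟩ := List.append_inj hmap (by simp [ha])
  have h0 : s 0 = τ * s' 0 * τ⁻¹ := by
    rw [h.eq_zero, h'.eq_zero, ← formPerm_map, List.map_cons, List.map_append, hx, hla, hlb]
  have h1 : s 1 = τ * s' 1 * τ⁻¹ := by
    rw [h.eq_one, h'.eq_one, ← formPerm_map, List.map_cons, List.map_append, List.map_reverse, hx,
      hla, hlc]
  have h2 : s 2 = τ * s' 2 * τ⁻¹ := by
    rw [← inv_eq_of_mul_eq_one_right h.prod, ← inv_eq_of_mul_eq_one_right h'.prod, h0, h1]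
    group
  refine ⟨τ, hx, hla, hlb, hlc, fun i => ?_⟩
  fin_cases i
  · exact h0
  · exact h1
  · exact h2

lemma IsNormalForm.nodup_points {s : Fin 3 → Perm α} {x a b c : α} {la lb lc : List α}
    (h : IsNormalForm s x (la ++ [a]) (b :: lb) (c :: lc)) : [x, c, a, b].Nodup := by
  have := h.nodup
  simp only [List.append_assoc, List.cons_append, List.nil_append, List.nodup_cons, List.mem_append,
    List.mem_cons, List.nodup_append, not_or, List.not_mem_nil, not_false_eq_true, List.nodup_nil,
    and_true, or_false] at this ⊢
  grind

/-- If each of the three permutations has a fixed point, then the commutator of the first two is a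
double transposition. -/
theorem IsNormalForm.commutator_eq {s : Fin 3 → Perm α} {x a b c : α} {la lb lc : List α}
    (h : IsNormalForm s x (la ++ [a]) (b :: lb) (c :: lc)) :
    s 0 * s 1 * (s 0)⁻¹ * (s 1)⁻¹ = swap x c * swap a b := by
  have hnd := h.nodup
  have hnd0 : (x :: ((la ++ [a]) ++ b :: lb)).Nodup := by
    rw [← List.cons_append] at hnd
    exact hnd.of_append_left
  have hmap0 := map_formPerm hnd0
  rw [← h.eq_zero] at hmap0
  -- Conjugation by `s 0` shifts the part `x, la, a` of the cycle `s 1` by one step and leaves `c ::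
  -- lc` alone. The conjugate and `s 1` thus differ only in that `b` before `a` replaces `x` before
  -- `c`, which costs one transposition each.
  have hmap1 : (x :: (la ++ [a])).map (s 0) = la ++ [a] ++ [b] := by
    have h1 : (x :: ((la ++ [a]) ++ b :: lb)).rotate 1 =
        (la ++ [a] ++ [b]) ++ (lb ++ [x]) := by simp
    rw [h1, ← List.cons_append, List.map_append] at hmap0
    exact (List.append_inj hmap0 (by simp)).1
  have hmap2 : (c :: lc).map (s 0) = c :: lc := by
    rw [List.map_congr_left (g := id), List.map_id]
    intro p hp
    have hp' : p ∉ x :: ((la ++ [a]) ++ b :: lb) := by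
      intro h1
      rw [← List.cons_append] at hnd
      exact List.disjoint_of_nodup_append hnd h1 hp
    rw [h.eq_zero, List.formPerm_apply_of_notMem hp', id]
  have hnd1 : (x :: (c :: lc ++ (la ++ [a]).reverse)).Nodup := by
    have : (x :: (c :: lc ++ (la ++ [a]).reverse)).Perm
        (x :: ((la ++ [a]) ++ c :: lc)) := by
      refine List.Perm.cons _ (List.perm_append_comm.trans ?_)
      exact (List.reverse_perm _).append_right _
    rw [this.nodup_iff]
    refine hnd.sublist ?_
    rw [List.cons_sublist_cons]
    exact (List.sublist_append_left (la ++ [a]) (b :: lb)).append_right (c :: lc)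
  have hrot1 : s 1 = ((c :: lc) ++ (x :: (la ++ [a])).reverse).formPerm := by
    rw [h.eq_one, ← List.formPerm_rotate_one _ hnd1]
    congr 1
    simp
  have hconj : s 0 * s 1 * (s 0)⁻¹ = ((c :: lc) ++ b :: a :: la.reverse).formPerm := by
    conv_lhs => rw [hrot1]
    rw [← formPerm_map, List.map_append, hmap2, List.map_reverse, hmap1]
    simp
  have hnd2 : (a :: (la.reverse ++ (c :: lc))).Nodup := by
    have : (a :: (la.reverse ++ c :: lc)).Perm (c :: lc ++ (la ++ [a]).reverse) := by
      rw [List.reverse_append, List.reverse_singleton, List.singleton_append, ← List.cons_append]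
      exact List.perm_append_comm
    rw [this.nodup_iff]
    exact (List.nodup_cons.1 hnd1).2
  have hnd3 : (b :: a :: (la.reverse ++ (c :: lc))).Nodup := by
    rw [List.nodup_cons]
    refine ⟨?_, hnd2⟩
    intro hb
    rw [List.nodup_cons, List.append_assoc] at hnd
    have h1 := hnd.2
    have h2 : b ∈ (la ++ [a]) ∨ b ∈ c :: lc := by
      simp only [List.mem_cons, List.mem_append, List.mem_reverse] at hb ⊢
      tauto
    rcases h2 with h2 | h2
    · exact List.disjoint_of_nodup_append h1 h2 (by simp)
    · have h3 := (List.nodup_append.1 h1).2.1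
      rw [List.cons_append, List.nodup_cons] at h3
      exact h3.1 (List.mem_append_right _ h2)
  have hstep : ((c :: lc) ++ b :: a :: la.reverse).formPerm =
      swap a b * ((c :: lc) ++ a :: la.reverse).formPerm := by
    have e1 : ((c :: lc) ++ b :: a :: la.reverse).formPerm =
        (b :: a :: (la.reverse ++ (c :: lc))).formPerm := by
      refine (List.formPerm_eq_of_isRotated hnd3 ?_).symm
      have := List.isRotated_append (l := b :: a :: la.reverse) (l' := c :: lc)
      simpa using this
    have e2 : ((c :: lc) ++ a :: la.reverse).formPerm =
        (a :: (la.reverse ++ (c :: lc))).formPerm := by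
      refine (List.formPerm_eq_of_isRotated hnd2 ?_).symm
      have := List.isRotated_append (l := a :: la.reverse) (l' := c :: lc)
      simpa using this
    rw [e1, e2, List.formPerm_cons_cons, swap_comm]
  have hs1 : s 1 = swap x c * ((c :: lc) ++ a :: la.reverse).formPerm := by
    rw [h.eq_one, List.cons_append, List.formPerm_cons_cons]
    simp
  have hdisj : Perm.Disjoint (swap x c) (swap a b) := Perm.disjoint_swap_swap h.nodup_points
  rw [hconj, hstep, hs1, mul_inv_rev, swap_inv, ← mul_assoc, mul_inv_cancel_right]
  exact hdisj.commute.eq.symm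

end NormalForm

end PureCycle

namespace PureCycle

open Equiv MulAction

/-! ### Monodromy groups containing the alternating group. -/

section Structure

variable {d r : ℕ} {e : Fin r → ℕ} {σ : Fin r → Perm (Fin d)}

lemma IsHurwitzFactorization.length_le (h : IsHurwitzFactorization d r 0 e σ) (i : Fin r) :
    e i ≤ d := by
  rw [← h.card_support i]
  simpa using Finset.card_le_univ (σ i).support

lemma IsHurwitzFactorization.sum_length (h : IsHurwitzFactorization d r 0 e σ) :
    ∑ i, e i + 2 = 2 * d + r := by
  have := h.problem.riemann_hurwitz
  simp only [Finset.sum_sub_distrib, Finset.sum_const, Finset.card_univ, Fintype.card_fin] at this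
  zify
  simp at this
  linarith

lemma IsHurwitzFactorization.two_le_degree (h : IsHurwitzFactorization d r 0 e σ) : 2 ≤ d := by
  have hr := h.problem.two_le_length
  exact (h.problem.two_le ⟨0, by omega⟩).trans (h.length_le _)

lemma IsHurwitzFactorization.exists_apply_ne (h : IsHurwitzFactorization d r 0 e σ) (p : Fin d) :
    ∃ i, σ i p ≠ p := by
  by_contra! hall
  have hfix : ∀ g ∈ monodromyGroup σ, g p = p := by
    intro g hg
    induction hg using Subgroup.closure_induction with
    | mem g hg => obtain ⟨i, rfl⟩ := hg; exact hall i
    | one => rfl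
    | mul x y _ _ hx hy => rw [Perm.mul_apply, hy, hx]
    | inv x _ hx => exact Perm.inv_eq_iff_eq.2 hx.symm
  have := h.transitive
  have h2 := h.two_le_degree
  have : Nontrivial (Fin d) := Fin.nontrivial_iff_two_le.2 h2
  obtain ⟨q, hq⟩ := exists_ne p
  obtain ⟨g, hg⟩ := exists_smul_eq (monodromyGroup σ) p q
  exact hq (hg.symm.trans (hfix g g.2))

lemma IsHurwitzFactorization.exists_isNormalForm {e : Fin 3 → ℕ} {σ : Fin 3 → Perm (Fin d)}
    (h : IsHurwitzFactorization d 3 0 e σ) : ∃ x la lb lc, IsNormalForm σ x la lb lc := by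
  refine PureCycle.exists_isNormalForm h.isCycle ?_ ?_ ?_
  · have := h.prod_eq_one
    simpa [List.ofFn_succ, mul_assoc] using this
  · have := h.sum_length
    rw [Fin.sum_univ_three] at this
    rw [h.card_support, h.card_support, h.card_support, Fintype.card_fin]
    omega
  · rintro p ⟨h0, h1, h2⟩
    obtain ⟨i, hi⟩ := h.exists_apply_ne p
    fin_cases i
    · exact hi h0
    · exact hi h1
    · exact hi h2

/-- Two genus-zero pure-cycle factorizations with three factors of the same lengths are
simultaneously conjugate. -/
theorem exists_conj_of_three_factors {e : Fin 3 → ℕ} {σ σ' : Fin 3 → Perm (Fin d)}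
    (h : IsHurwitzFactorization d 3 0 e σ) (h' : IsHurwitzFactorization d 3 0 e σ') :
    ∃ τ : Perm (Fin d), ∀ i, σ i = τ * σ' i * τ⁻¹ := by
  obtain ⟨x, la, lb, lc, hn⟩ := h.exists_isNormalForm
  obtain ⟨x', la', lb', lc', hn'⟩ := h'.exists_isNormalForm
  have ha := hn.length_a
  have hb := hn.length_b
  have hc := hn.length_c
  have ha' := hn'.length_a
  have hb' := hn'.length_b
  have hc' := hn'.length_c
  rw [h.card_support] at ha hb hc
  rw [h'.card_support] at ha' hb' hc'
  obtain ⟨τ, -, -, -, -, hτ⟩ := hn.exists_conj hn' (by omega) (by omega) (by omega)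
  exact ⟨τ, hτ⟩

lemma univ_val_map_fin_three (e : Fin 3 → ℕ) :
    Finset.univ.val.map e = ({e 0, e 1, e 2} : Multiset ℕ) := by
  rw [Fin.univ_val_map]
  simp [List.ofFn_succ]
  rfl

/-- The model triple of lengths `5, 5, 5`; by rigidity a computation with it settles that case. -/
lemma isNormalForm_degree_seven :
    IsNormalForm (α := Fin 7) ![[0, 1, 2, 3, 4].formPerm, [0, 5, 6, 2, 1].formPerm,
      ([0, 1, 2, 3, 4].formPerm * [0, 5, 6, 2, 1].formPerm)⁻¹] 0 [1, 2] [3, 4] [5, 6] where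
  nodup := by decide
  mem := by decide
  length_a := by decide
  length_b := by decide
  length_c := by decide
  eq_zero := rfl
  eq_one := rfl
  prod := by decide

set_option maxRecDepth 4000 in
theorem exists_isThreeCycle_of_three_factors {e : Fin 3 → ℕ} {σ : Fin 3 → Perm (Fin d)}
    (h : IsHurwitzFactorization d 3 0 e σ)
    (hne : Finset.univ.val.map e ≠ ({4, 4, 5} : Multiset ℕ)) :
    ∃ g ∈ monodromyGroup σ, g.IsThreeCycle := by
  have hprim := h.isPreprimitive le_rfl
  have hmem := mem_monodromyGroup σ
  have hsum := h.sum_length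
  rw [Fin.sum_univ_three] at hsum
  by_cases hsmall : ∃ i, 2 * e i ≤ d + 1
  · obtain ⟨i, hi⟩ := hsmall
    exact exists_isThreeCycle_of_two_mul_card_support_le hprim (h.isCycle i) (hmem i)
      (by rwa [h.card_support, Fintype.card_fin])
  -- From here `2 * e i ≥ d + 2` for all `i`. With total length `2d + 1`, no factor can be a
  -- `d`-cycle, so the lists `la`, `lb`, `lc` are nonempty.
  push Not at hsmall
  have hs0 := hsmall 0
  have hs1 := hsmall 1
  have hs2 := hsmall 2
  obtain ⟨x, la, lb, lc, hn⟩ := h.exists_isNormalForm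
  have ha := hn.length_a
  have hb := hn.length_b
  have hc := hn.length_c
  rw [h.card_support, Fintype.card_fin] at ha hb hc
  by_cases hbig : ∃ i, e i + 3 ≤ d
  · obtain ⟨i, hi⟩ := hbig
    have htrans := isMultiplyPretransitive_of_isCycle_mem hprim (h.isCycle i) (hmem i)
    rw [h.card_support, Fintype.card_fin] at htrans
    have h4 : IsMultiplyPretransitive (monodromyGroup σ) (Fin d) 4 :=
      isMultiplyPretransitive_of_le (n := d - e i + 1) (by omega)
        (by rw [Nat.card_eq_fintype_card, Fintype.card_fin]; have := h.problem.two_le i; omega)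
    rcases List.eq_nil_or_concat' la with rfl | ⟨la, a, rfl⟩
    · simp at ha; omega
    rcases lb with _ | ⟨b, lb⟩
    · simp at hb; omega
    rcases lc with _ | ⟨c, lc⟩
    · simp at hc; omega
    have hi2 := h.problem.two_le i
    refine exists_isThreeCycle_of_double_swap h4 (by rw [Fintype.card_fin]; omega)
      hn.nodup_points ?_
    rw [← hn.commutator_eq]
    exact mul_mem (mul_mem (mul_mem (hmem 0) (hmem 1)) (inv_mem (hmem 0))) (inv_mem (hmem 1))
  -- Each factor now fixes at most two points and at most `(d - 2) / 2`, and the three numbers of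
  -- fixed points sum to `d - 1`. This leaves `d = 4` with lengths `3, 3, 3`, `d = 6` with the
  -- excluded lengths, and `d = 7` with `5, 5, 5`.
  push Not at hbig
  have hb0 := hbig 0
  have hb1 := hbig 1
  have hb2 := hbig 2
  by_cases h3 : e 0 = 3
  · exact ⟨σ 0, hmem 0, by rw [← card_support_eq_three_iff, h.card_support, h3]⟩
  by_cases h445 : d = 6
  · exfalso
    apply hne
    rw [univ_val_map_fin_three]
    have : (e 0 = 4 ∧ e 1 = 4 ∧ e 2 = 5) ∨ (e 0 = 4 ∧ e 1 = 5 ∧ e 2 = 4) ∨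
        (e 0 = 5 ∧ e 1 = 4 ∧ e 2 = 4) := by omega
    rcases this with ⟨h0, h1, h2⟩ | ⟨h0, h1, h2⟩ | ⟨h0, h1, h2⟩ <;> rw [h0, h1, h2] <;> decide
  have h7 : d = 7 := by omega
  subst h7
  obtain ⟨τ, -, -, -, -, hτ⟩ := hn.exists_conj isNormalForm_degree_seven
    (by simp; omega) (by simp; omega) (by simp; omega)
  -- An explicit word, the square of `σ 0 ^ 2 * (σ 1)⁻¹`, that is a 3-cycle in the model.
  refine ⟨σ 0 * σ 0 * (σ 1)⁻¹ * σ 0 * σ 0 * (σ 1)⁻¹, ?_, ?_⟩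
  · exact mul_mem (mul_mem (mul_mem (mul_mem (mul_mem (hmem 0) (hmem 0)) (inv_mem (hmem 1)))
      (hmem 0)) (hmem 0)) (inv_mem (hmem 1))
  · rw [hτ 0, hτ 1]
    simp only [Matrix.cons_val_zero, Matrix.cons_val_one]
    generalize hw0 : ([0, 1, 2, 3, 4] : List (Fin 7)).formPerm = w₀
    generalize hw1 : ([0, 5, 6, 2, 1] : List (Fin 7)).formPerm = w₁
    have hw : τ * w₀ * τ⁻¹ * (τ * w₀ * τ⁻¹) * (τ * w₁ * τ⁻¹)⁻¹ * (τ * w₀ * τ⁻¹) *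
        (τ * w₀ * τ⁻¹) * (τ * w₁ * τ⁻¹)⁻¹ = τ * (w₀ * w₀ * w₁⁻¹ * w₀ * w₀ * w₁⁻¹) * τ⁻¹ := by
      group
    rw [hw, ← card_support_eq_three_iff, Perm.card_support_conj, ← hw0, ← hw1]
    decide

/-- Apart from the case of lengths `4, 4, 5`, the monodromy group of a genus-zero pure-cycle
factorization with at least three factors contains the alternating group. -/
theorem IsHurwitzFactorization.alternatingGroup_le (h : IsHurwitzFactorization d r 0 e σ)
    (hr : 3 ≤ r) (hne : Finset.univ.val.map e ≠ ({4, 4, 5} : Multiset ℕ)) :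
    alternatingGroup (Fin d) ≤ monodromyGroup σ := by
  have hprim := h.isPreprimitive hr
  obtain ⟨g, hg, hg3⟩ : ∃ g ∈ monodromyGroup σ, g.IsThreeCycle := by
    rcases hr.eq_or_lt with rfl | hr4
    · exact exists_isThreeCycle_of_three_factors h hne
    -- If all lengths were larger, `r(d + 2) ≤ 2(2d + r - 2)`, that is `rd ≤ 4d - 4`, impossible for
    -- `r ≥ 4`.
    · obtain ⟨i, hi⟩ : ∃ i, 2 * e i ≤ d + 1 := by
        by_contra! hall
        have h1 : ∑ _i : Fin r, (d + 2) ≤ ∑ i, 2 * e i :=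
          Finset.sum_le_sum fun i _ => hall i
        rw [← Finset.mul_sum, Finset.sum_const, Finset.card_univ, Fintype.card_fin,
          smul_eq_mul] at h1
        have h2 := h.sum_length
        have h3 := h.two_le_degree
        nlinarith
      exact exists_isThreeCycle_of_two_mul_card_support_le hprim (h.isCycle i)
        (mem_monodromyGroup σ i) (by rwa [h.card_support, Fintype.card_fin])
  exact Perm.alternatingGroup_le_of_isPreprimitive_of_isThreeCycle_mem hprim hg3 hg

lemma IsHurwitzFactorization.sign_eq (h : IsHurwitzFactorization d r 0 e σ) (i : Fin r) :
    Perm.sign (σ i) = -(-1) ^ e i := by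
  rw [(h.isCycle i).sign, h.card_support]

theorem IsHurwitzFactorization.monodromyGroup_eq_alternatingGroup
    (h : IsHurwitzFactorization d r 0 e σ) (hA : alternatingGroup (Fin d) ≤ monodromyGroup σ)
    (hodd : ∀ i, Odd (e i)) : monodromyGroup σ = alternatingGroup (Fin d) := by
  refine le_antisymm ?_ hA
  rw [monodromyGroup, Subgroup.closure_le]
  rintro _ ⟨i, rfl⟩
  rw [SetLike.mem_coe, Perm.mem_alternatingGroup, h.sign_eq, (hodd i).neg_one_pow, neg_neg]

theorem IsHurwitzFactorization.monodromyGroup_eq_top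
    (h : IsHurwitzFactorization d r 0 e σ) (hA : alternatingGroup (Fin d) ≤ monodromyGroup σ)
    (heven : ∃ i, Even (e i)) : monodromyGroup σ = ⊤ := by
  obtain ⟨i, hi⟩ := heven
  have hs : Perm.sign (σ i) = -1 := by rw [h.sign_eq, hi.neg_one_pow]
  rw [eq_top_iff]
  intro g _
  rcases Int.units_eq_one_or (Perm.sign g) with hg | hg
  · exact hA (Perm.mem_alternatingGroup.2 hg)
  · have h1 : g * σ i ∈ monodromyGroup σ := by
      apply hA
      rw [Perm.mem_alternatingGroup, Perm.sign_mul, hg, hs]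
      decide
    have h2 := mul_mem h1 (inv_mem (mem_monodromyGroup σ i))
    rwa [mul_inv_cancel_right] at h2

end Structure

/-! ### Two factors: the cyclic case. -/

section TwoFactors

variable {d : ℕ} {e : Fin 2 → ℕ} {σ : Fin 2 → Perm (Fin d)}

lemma IsHurwitzFactorization.eq_inv_of_two_factors (h : IsHurwitzFactorization d 2 0 e σ) :
    σ 1 = (σ 0)⁻¹ := by
  have := h.prod_eq_one
  rw [List.ofFn_succ, List.ofFn_succ, List.ofFn_zero] at this
  simp only [List.prod_cons, List.prod_nil, mul_one] at this
  exact (inv_eq_of_mul_eq_one_right this).symm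

lemma IsHurwitzFactorization.length_eq_of_two_factors (h : IsHurwitzFactorization d 2 0 e σ) :
    e 0 = d := by
  have h0 := h.length_le 0
  have h1 := h.length_le 1
  have h2 := h.sum_length
  rw [Fin.sum_univ_two] at h2
  omega

lemma IsHurwitzFactorization.monodromyGroup_eq_zpowers (h : IsHurwitzFactorization d 2 0 e σ) :
    monodromyGroup σ = Subgroup.zpowers (σ 0) := by
  apply le_antisymm
  · rw [monodromyGroup, Subgroup.closure_le]
    rintro _ ⟨i, rfl⟩
    fin_cases i
    · exact Subgroup.mem_zpowers _
    · change σ 1 ∈ _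
      rw [h.eq_inv_of_two_factors]
      exact inv_mem (Subgroup.mem_zpowers _)
  · rw [Subgroup.zpowers_le]
    exact mem_monodromyGroup σ 0

theorem IsHurwitzFactorization.nonempty_mulEquiv_zmod (h : IsHurwitzFactorization d 2 0 e σ) :
    Nonempty (monodromyGroup σ ≃* Multiplicative (ZMod d)) := by
  rw [h.monodromyGroup_eq_zpowers]
  have : NeZero d := ⟨by have := h.two_le_degree; omega⟩
  refine ⟨mulEquivOfCyclicCardEq ?_⟩
  rw [Nat.card_zpowers, (h.isCycle 0).orderOf, h.card_support, h.length_eq_of_two_factors]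
  simp

end TwoFactors

/-! ### Nielsen classes. -/

section Nielsen

variable {d r : ℕ} {e : Fin r → ℕ} {σ σ' : Fin r → Perm (Fin d)}

lemma sameNielsenClass_of_conj {τ : Perm (Fin d)} (h : ∀ i, σ i = τ * σ' i * τ⁻¹) :
    SameNielsenClass σ σ' := by
  have h1 : (fun i => τ * σ' i * τ⁻¹) = σ := funext fun i => (h i).symm
  refine ⟨τ, by rw [h1], fun i => ⟨1, one_mem _, ?_⟩⟩
  rw [one_mul, inv_one, mul_one, h i]

lemma monodromyGroup_conj (τ : Perm (Fin d)) (σ : Fin r → Perm (Fin d)) :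
    monodromyGroup (fun i => τ * σ i * τ⁻¹) =
      (monodromyGroup σ).map (MulAut.conj τ).toMonoidHom := by
  rw [monodromyGroup, monodromyGroup, MonoidHom.map_closure, ← Set.range_comp]
  rfl

lemma IsHurwitzFactorization.isConj (h : IsHurwitzFactorization d r 0 e σ)
    (h' : IsHurwitzFactorization d r 0 e σ') (i : Fin r) :
    ∃ τ : Perm (Fin d), τ * σ' i * τ⁻¹ = σ i := by
  rw [← isConj_iff, (h'.isCycle i).isConj_iff (h.isCycle i), h.card_support, h'.card_support]

/-- With at least four odd lengths, at most one of the cycles fixes fewer than two points. -/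
lemma IsHurwitzFactorization.exists_forall_ne_length_add_two_le
    (h : IsHurwitzFactorization d r 0 e σ) (hr : 4 ≤ r) (hodd : ∀ i, Odd (e i)) :
    ∃ i₀, ∀ i, i ≠ i₀ → e i + 2 ≤ d := by
  by_cases hall : ∀ i, e i + 2 ≤ d
  · exact ⟨⟨0, by omega⟩, fun i _ => hall i⟩
  push Not at hall
  obtain ⟨i₀, hi₀⟩ := hall
  refine ⟨i₀, fun i hi => ?_⟩
  by_contra hlt
  have h3 : ∀ j, 3 ≤ e j := fun j => by
    have h2 := h.problem.two_le j
    obtain ⟨k, hk⟩ := hodd j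
    omega
  have h1 := Finset.sum_erase_add Finset.univ e (Finset.mem_univ i₀)
  have h2 := Finset.sum_erase_add (Finset.univ.erase i₀) e
    (Finset.mem_erase.2 ⟨hi, Finset.mem_univ i⟩)
  -- Two lengths of at least `d - 1` and the rest at least `3` would give `2d + r - 2 ≥ 2(d - 1) +
  -- 3(r - 2)`, so `r ≤ 3`.
  have h4 : _ ≤ ∑ j ∈ (Finset.univ.erase i₀).erase i, e j :=
    Finset.card_nsmul_le_sum _ e 3 fun j _ => h3 j
  rw [Finset.card_erase_of_mem (Finset.mem_erase.2 ⟨hi, Finset.mem_univ i⟩),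
    Finset.card_erase_of_mem (Finset.mem_univ i₀), Finset.card_univ, Fintype.card_fin,
    smul_eq_mul] at h4
  have h5 := h.sum_length
  omega

theorem sameNielsenClass (h : IsHurwitzFactorization d r 0 e σ)
    (h' : IsHurwitzFactorization d r 0 e σ') : SameNielsenClass σ σ' := by
  have hr := h.problem.two_le_length
  rcases hr.eq_or_lt with rfl | hr3
  · obtain ⟨τ, hτ⟩ := h.isConj h' 0
    refine sameNielsenClass_of_conj (τ := τ) fun i => ?_
    fin_cases i
    · exact hτ.symm
    · change σ 1 = τ * σ' 1 * τ⁻¹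
      rw [h.eq_inv_of_two_factors, h'.eq_inv_of_two_factors, ← hτ]
      group
  rcases (show 3 ≤ r from hr3).eq_or_lt with rfl | hr4
  · obtain ⟨τ, hτ⟩ := exists_conj_of_three_factors h h'
    exact sameNielsenClass_of_conj hτ
  have hne : Finset.univ.val.map e ≠ ({4, 4, 5} : Multiset ℕ) := by
    intro heq
    have := congrArg Multiset.card heq
    simp at this
    omega
  have hA := h.alternatingGroup_le hr3 hne
  have hA' := h'.alternatingGroup_le hr3 hne
  by_cases hodd : ∀ i, Odd (e i)
  -- `τ` is spent on matching the one cycle whose class might split in `A_d`. All the others fix at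
  -- least two points, so their `S_d`-conjugacy can be realized in `A_d`.
  · obtain ⟨i₀, hi₀⟩ := h.exists_forall_ne_length_add_two_le hr4 hodd
    obtain ⟨τ, hτ⟩ := h.isConj h' i₀
    have hG := h.monodromyGroup_eq_alternatingGroup hA hodd
    have hG' := h'.monodromyGroup_eq_alternatingGroup hA' hodd
    refine ⟨τ, ?_, fun i => ?_⟩
    · rw [monodromyGroup_conj, hG, hG']
      exact Subgroup.Normal.map_conj_eq _ _
    · by_cases hi : i = i₀
      · subst hi
        exact ⟨1, one_mem _, by rw [one_mul, inv_one, mul_one, hτ]⟩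
      · have hmem : ∀ τ : Perm (Fin d), Perm.sign (τ * σ' i * τ⁻¹) = 1 := by
          intro τ
          rw [Perm.sign_mul, Perm.sign_mul, Perm.sign_inv, mul_right_comm,
            Int.units_mul_self, one_mul, h'.sign_eq, (hodd i).neg_one_pow, neg_neg]
        have hσ : Perm.sign (σ i) = 1 := by
          rw [h.sign_eq, (hodd i).neg_one_pow, neg_neg]
        have hconj := alternatingGroup.isConj_of
          (σ := ⟨σ i, Perm.mem_alternatingGroup.2 hσ⟩)
          (τ := ⟨τ * σ' i * τ⁻¹, Perm.mem_alternatingGroup.2 (hmem τ)⟩) (by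
            obtain ⟨ρ, hρ⟩ := h.isConj h' i
            change IsConj (σ i) (τ * σ' i * τ⁻¹)
            exact (isConj_iff.2 ⟨ρ, hρ⟩).symm.trans (isConj_iff.2 ⟨τ, rfl⟩)) (by
            change (σ i).support.card + 2 ≤ _
            rw [h.card_support, Fintype.card_fin]; exact hi₀ i hi)
        obtain ⟨g, hg⟩ := isConj_iff.1 hconj
        exact ⟨g, by rw [hG]; exact g.2, congrArg Subtype.val hg⟩
  · have heven : ∃ i, Even (e i) := by
      push Not at hodd
      obtain ⟨i, hi⟩ := hodd
      exact ⟨i, Nat.not_odd_iff_even.1 hi⟩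
    have hG := h.monodromyGroup_eq_top hA heven
    have hG' := h'.monodromyGroup_eq_top hA' heven
    refine ⟨1, ?_, fun i => ?_⟩
    · rw [hG]
      simpa using hG'
    · obtain ⟨τ, hτ⟩ := h'.isConj h i
      exact ⟨τ, by rw [hG]; trivial, by simpa using hτ⟩

end Nielsen

end PureCycle

namespace PureCycle

open Equiv MulAction

/-! ### Lengths `4, 4, 5` and the exotic `S₅` in `S₆`. -/

section ExceptionalCase

/-- The five synthemes of a total on six points. -/
def syntheme : Fin 5 → Perm (Fin 6) :=
  ![swap 0 1 * swap 2 5 * swap 3 4, swap 0 2 * swap 1 3 * swap 4 5,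
    swap 0 3 * swap 1 5 * swap 2 4, swap 0 4 * swap 1 2 * swap 3 5,
    swap 0 5 * swap 1 4 * swap 2 3]

/-- The pairs consisting of a permutation of six points preserving the total and the permutation
it induces on the five synthemes. -/
def synthemeGraph : Subgroup (Perm (Fin 6) × Perm (Fin 5)) where
  carrier := {g | ∀ c, g.1 * syntheme c * g.1⁻¹ = syntheme (g.2 c)}
  one_mem' := fun c => by simp
  mul_mem' := fun {g h} hg hh c => by
    rw [Prod.fst_mul, Prod.snd_mul, Perm.mul_apply, ← hg, ← hh]
    group
  inv_mem' := fun {g} hg c => by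
    have h := hg (g.2⁻¹ c)
    rw [← Perm.mul_apply, mul_inv_cancel, Perm.one_apply] at h
    rw [Prod.fst_inv, Prod.snd_inv, ← h]
    group

lemma syntheme_injective : Function.Injective syntheme := by
  decide

lemma exists_syntheme_apply_zero : ∀ x : Fin 6, x ≠ 0 → ∃ c, syntheme c 0 = x := by
  decide

/-- The point `0` is singled out by the relations among its images under the synthemes. A
permutation commuting with all synthemes preserves these relations, hence fixes `0` and then every
point. -/
lemma eq_zero_of_syntheme : ∀ y : Fin 6,
    (∀ c c' c'', syntheme c' (syntheme c 0) = syntheme c'' 0 →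
      syntheme c' (syntheme c y) = syntheme c'' y) → y = 0 := by
  decide

lemma eq_one_of_forall_commute_syntheme {g : Perm (Fin 6)}
    (hg : ∀ c x, g (syntheme c x) = syntheme c (g x)) : g = 1 := by
  have h0 : g 0 = 0 := by
    apply eq_zero_of_syntheme
    intro c c' c'' h
    rw [← hg, ← hg, h, hg]
  ext x : 1
  by_cases hx : x = 0
  · rw [hx, h0]; rfl
  · obtain ⟨c, rfl⟩ := exists_syntheme_apply_zero x hx
    rw [hg, h0]; rfl

lemma fst_injOn_synthemeGraph :
    Set.InjOn Prod.fst (synthemeGraph : Set (Perm (Fin 6) × Perm (Fin 5))) := by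
  intro g hg h hh hgh
  refine Prod.ext hgh (Equiv.ext fun c => syntheme_injective ?_)
  rw [← hg c, ← hh c, hgh]

lemma snd_injOn_synthemeGraph :
    Set.InjOn Prod.snd (synthemeGraph : Set (Perm (Fin 6) × Perm (Fin 5))) := by
  intro g hg h hh hgh
  have hk : ∀ c, (h⁻¹ * g).1 * syntheme c * (h⁻¹ * g).1⁻¹ = syntheme ((h⁻¹ * g).2 c) :=
    synthemeGraph.mul_mem (synthemeGraph.inv_mem hh) hg
  have h2 : (h⁻¹ * g).2 = 1 := by
    rw [Prod.snd_mul, Prod.snd_inv, hgh, inv_mul_cancel]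
  have h1 : (h⁻¹ * g).1 = 1 := by
    refine eq_one_of_forall_commute_syntheme fun c x => ?_
    have := hk c
    rw [h2, Perm.one_apply, mul_inv_eq_iff_eq_mul] at this
    exact Equiv.congr_fun this x
  exact Prod.ext (inv_mul_eq_one.1 h1).symm hgh

/-- The two 4-cycles generate a 5-cycle and a transposition, and `5` is prime. -/
lemma closure_two_cycles_eq_top :
    Subgroup.closure {([0, 3, 4, 2] : List (Fin 5)).formPerm, ([0, 3, 1, 2] : List (Fin 5)).formPerm}
      = ⊤ := by
  set a := ([0, 3, 4, 2] : List (Fin 5)).formPerm with ha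
  set b := ([0, 3, 1, 2] : List (Fin 5)).formPerm with hb
  have hab : a * b = [0, 4, 2, 3, 1].formPerm := by decide
  have hsw : a * a * b * a * b = swap 1 2 := by decide
  have hamem : a ∈ Subgroup.closure {a, b} := Subgroup.subset_closure (by simp)
  have hbmem : b ∈ Subgroup.closure {a, b} := Subgroup.subset_closure (by simp)
  rw [eq_top_iff, ← Perm.closure_prime_cycle_swap (σ := a * b) (τ := swap 1 2) (by decide)
    (by rw [hab]; exact List.isCycle_formPerm (by decide) (by decide)) (by rw [hab]; decide)
    ⟨1, 2, by decide, rfl⟩, Subgroup.closure_le]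
  rintro g (rfl | rfl)
  · exact mul_mem hamem hbmem
  · rw [SetLike.mem_coe, ← hsw]
    exact mul_mem (mul_mem (mul_mem (mul_mem hamem hamem) hbmem) hamem) hbmem

/-- The exotic transitive copy of `S₅` in `S₆`. -/
theorem nonempty_closure_mulEquiv :
    Nonempty (Subgroup.closure {([0, 1, 2, 3] : List (Fin 6)).formPerm,
      ([0, 4, 5, 1] : List (Fin 6)).formPerm} ≃* Perm (Fin 5)) := by
  let S : Set (Perm (Fin 6) × Perm (Fin 5)) :=
    {([0, 1, 2, 3].formPerm, [0, 3, 4, 2].formPerm), ([0, 4, 5, 1].formPerm, [0, 3, 1, 2].formPerm)}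
  let K := Subgroup.closure S
  -- Inside `synthemeGraph` each coordinate determines the other, so `K` is isomorphic to both of
  -- its projections: the group in `S₆` and all of `S₅`.
  have hK : K ≤ synthemeGraph := by
    rw [Subgroup.closure_le]
    rintro g (rfl | rfl)
    · change ∀ c, _
      decide
    · change ∀ c, _
      decide
  have hfst : K.map (MonoidHom.fst _ _) = Subgroup.closure {([0, 1, 2, 3] : List (Fin 6)).formPerm,
      ([0, 4, 5, 1] : List (Fin 6)).formPerm} := by
    rw [MonoidHom.map_closure, Set.image_pair]; rfl
  have hsnd : K.map (MonoidHom.snd _ _) = ⊤ := by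
    rw [MonoidHom.map_closure, Set.image_pair]; exact closure_two_cycles_eq_top
  let f₁ : K →* Perm (Fin 6) := (MonoidHom.fst _ _).comp K.subtype
  let f₂ : K →* Perm (Fin 5) := (MonoidHom.snd _ _).comp K.subtype
  have hf₁ : Function.Injective f₁ := fun g h hgh =>
    Subtype.ext (fst_injOn_synthemeGraph (hK g.2) (hK h.2) hgh)
  have hf₂ : Function.Injective f₂ := fun g h hgh =>
    Subtype.ext (snd_injOn_synthemeGraph (hK g.2) (hK h.2) hgh)
  have hr₁ : f₁.range = Subgroup.closure {([0, 1, 2, 3] : List (Fin 6)).formPerm,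
      ([0, 4, 5, 1] : List (Fin 6)).formPerm} := by
    rw [← hfst, MonoidHom.range_comp, Subgroup.range_subtype]
  have hr₂ : f₂.range = ⊤ := by
    rw [← hsnd, MonoidHom.range_comp, Subgroup.range_subtype]
  rw [← hr₁]
  exact ⟨(MonoidHom.ofInjective hf₁).symm.trans
    (MulEquiv.ofBijective f₂ ⟨hf₂, MonoidHom.range_eq_top.1 hr₂⟩)⟩

lemma isNormalForm_degree_six :
    IsNormalForm (α := Fin 6) ![[0, 1, 2, 3].formPerm, [0, 4, 5, 1].formPerm,
      ([0, 1, 2, 3].formPerm * [0, 4, 5, 1].formPerm)⁻¹] 0 [1] [2, 3] [4, 5] where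
  nodup := by decide
  mem := by decide
  length_a := by decide
  length_b := by decide
  length_c := by decide
  eq_zero := rfl
  eq_one := rfl
  prod := by decide

lemma monodromyGroup_eq_closure_pair {d : ℕ} {s : Fin 3 → Perm (Fin d)}
    (hprod : s 0 * s 1 * s 2 = 1) : monodromyGroup s = Subgroup.closure {s 0, s 1} := by
  have h0 : s 0 ∈ Subgroup.closure {s 0, s 1} := Subgroup.subset_closure (by simp)
  have h1 : s 1 ∈ Subgroup.closure {s 0, s 1} := Subgroup.subset_closure (by simp)
  apply le_antisymm
  · rw [monodromyGroup, Subgroup.closure_le]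
    rintro _ ⟨i, rfl⟩
    fin_cases i
    · exact h0
    · exact h1
    · change s 2 ∈ _
      rw [← inv_eq_of_mul_eq_one_right hprod]
      exact inv_mem (mul_mem h0 h1)
  · rw [Subgroup.closure_le]
    rintro g (rfl | rfl)
    · exact mem_monodromyGroup s 0
    · exact mem_monodromyGroup s 1

variable {d : ℕ} {e : Fin 3 → ℕ} {σ : Fin 3 → Perm (Fin d)}

lemma monodromyGroup_rotate (σ : Fin 3 → Perm (Fin d)) :
    monodromyGroup (fun i => σ (i + 1)) = monodromyGroup σ := by
  rw [monodromyGroup, monodromyGroup]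
  congr 1
  exact (add_right_surjective (1 : Fin 3)).range_comp σ

/-- Cyclic rotation conjugates the product, so it stays `1`; this brings the 5-cycle to the last
place, as in the model. -/
lemma IsHurwitzFactorization.rotate (h : IsHurwitzFactorization d 3 0 e σ) :
    IsHurwitzFactorization d 3 0 (fun i => e (i + 1)) (fun i => σ (i + 1)) where
  problem :=
    { one_le_degree := h.problem.one_le_degree
      two_le_length := h.problem.two_le_length
      two_le := fun i => h.problem.two_le _
      riemann_hurwitz := by
        rw [h.problem.riemann_hurwitz]
        exact (Equiv.sum_comp (Equiv.addRight (1 : Fin 3)) fun i => (e i : ℤ) - 1).symm }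
  isCycle := fun i => h.isCycle _
  card_support := fun i => h.card_support _
  prod_eq_one := by
    have h1 : σ 0 * (σ 1 * σ 2) = 1 := by
      have := h.prod_eq_one
      simpa [List.ofFn_succ] using this
    have h2 : σ 1 * σ 2 * σ 0 = 1 := by
      rw [← inv_eq_of_mul_eq_one_right h1, inv_mul_cancel]
    simpa [List.ofFn_succ, mul_assoc] using h2
  transitive := by
    rw [monodromyGroup_rotate]; exact h.transitive

theorem nonempty_mulEquiv_of_lengths {σ : Fin 3 → Perm (Fin 6)} {e : Fin 3 → ℕ}
    (h : IsHurwitzFactorization 6 3 0 e σ) (h0 : e 0 = 4) (h1 : e 1 = 4) (h2 : e 2 = 5) :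
    Nonempty (monodromyGroup σ ≃* Perm (Fin 5)) := by
  obtain ⟨x, la, lb, lc, hn⟩ := h.exists_isNormalForm
  have ha := hn.length_a
  have hb := hn.length_b
  have hc := hn.length_c
  rw [h.card_support, Fintype.card_fin] at ha hb hc
  obtain ⟨τ, -, -, -, -, hτ⟩ := hn.exists_conj isNormalForm_degree_six
    (by simp; omega) (by simp; omega) (by simp; omega)
  have hmodel := monodromyGroup_eq_closure_pair isNormalForm_degree_six.prod
  rw [funext hτ, monodromyGroup_conj, hmodel]
  obtain ⟨f⟩ := nonempty_closure_mulEquiv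
  exact ⟨(Subgroup.equivMapOfInjective _ _ (MulAut.conj τ).injective).symm.trans f⟩

/-- In the case of lengths `4, 4, 5`, the monodromy group is a doubly transitive `S₅` in `S₆`. -/
theorem IsHurwitzFactorization.exceptional (h : IsHurwitzFactorization d 3 0 e σ)
    (he : Finset.univ.val.map e = ({4, 4, 5} : Multiset ℕ)) :
    d = 6 ∧ Nonempty (monodromyGroup σ ≃* Perm (Fin 5)) ∧
      IsMultiplyPretransitive (monodromyGroup σ) (Fin d) 2 := by
  have hcases : (e 0 = 4 ∧ e 1 = 4 ∧ e 2 = 5) ∨ (e 0 = 4 ∧ e 1 = 5 ∧ e 2 = 4) ∨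
      (e 0 = 5 ∧ e 1 = 4 ∧ e 2 = 4) := by
    have hmem : ∀ i, e i = 4 ∨ e i = 5 := by
      intro i
      have : e i ∈ Finset.univ.val.map e := Multiset.mem_map_of_mem e (Finset.mem_univ i)
      rw [he] at this
      simpa using this
    have hsum : e 0 + e 1 + e 2 = 13 := by
      have := congrArg Multiset.sum he
      rw [univ_val_map_fin_three] at this
      simpa [add_assoc] using this
    have := hmem 0
    have := hmem 1
    have := hmem 2
    omega
  have hd : d = 6 := by
    have := h.sum_length
    rw [Fin.sum_univ_three] at this
    omega
  subst hd
  refine ⟨rfl, ?_, ?_⟩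
  · rcases hcases with ⟨h0, h1, h2⟩ | ⟨h0, h1, h2⟩ | ⟨h0, h1, h2⟩
    · exact nonempty_mulEquiv_of_lengths h h0 h1 h2
    · rw [← monodromyGroup_rotate, ← monodromyGroup_rotate]
      exact nonempty_mulEquiv_of_lengths h.rotate.rotate h2 h0 h1
    · rw [← monodromyGroup_rotate]
      exact nonempty_mulEquiv_of_lengths h.rotate h1 h2 h0
  -- The 5-cycle has a single fixed point in degree 6, so Jordan's theorem gives exactly double
  -- transitivity.
  · obtain ⟨i, hi⟩ : ∃ i, e i = 5 := by
      rcases hcases with ⟨-, -, h2⟩ | ⟨-, h1, -⟩ | ⟨h0, -, -⟩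
      exacts [⟨2, h2⟩, ⟨1, h1⟩, ⟨0, h0⟩]
    have := isMultiplyPretransitive_of_isCycle_mem (h.isPreprimitive le_rfl) (h.isCycle i)
      (mem_monodromyGroup σ i)
    rwa [h.card_support, Fintype.card_fin, hi] at this

end ExceptionalCase

end PureCycle

theorem theorem5p3 (d r : ℕ) (e : Fin r → ℕ) :
    (∀ σ σ' : Fin r → Equiv.Perm (Fin d),
      PureCycle.IsHurwitzFactorization d r 0 e σ →
      PureCycle.IsHurwitzFactorization d r 0 e σ' →
      PureCycle.SameNielsenClass σ σ') ∧
    (∀ σ : Fin r → Equiv.Perm (Fin d),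
      PureCycle.IsHurwitzFactorization d r 0 e σ →
      (r = 2 → Nonempty (PureCycle.monodromyGroup σ ≃* Multiplicative (ZMod d))) ∧
      (Finset.univ.val.map e = ({4, 4, 5} : Multiset ℕ) →
        d = 6 ∧ Nonempty (PureCycle.monodromyGroup σ ≃* Equiv.Perm (Fin 5)) ∧
        MulAction.IsMultiplyPretransitive (PureCycle.monodromyGroup σ) (Fin d) 2) ∧
      (r ≠ 2 → Finset.univ.val.map e ≠ ({4, 4, 5} : Multiset ℕ) →
        ((∀ i, Odd (e i)) → PureCycle.monodromyGroup σ = alternatingGroup (Fin d)) ∧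
        ((∃ i, Even (e i)) → PureCycle.monodromyGroup σ = ⊤))) := by
  refine ⟨fun σ σ' h h' => PureCycle.sameNielsenClass h h', fun σ h => ⟨?_, ?_, ?_⟩⟩
  · rintro rfl
    exact h.nonempty_mulEquiv_zmod
  · intro he
    have hr : r = 3 := by simpa using congrArg Multiset.card he
    subst hr
    exact h.exceptional he
  · intro hr he
    have hr2 := h.problem.two_le_length
    have hA := h.alternatingGroup_le (by omega) he
    exact ⟨h.monodromyGroup_eq_alternatingGroup hA, h.monodromyGroup_eq_top hA⟩
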